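/- Let $y_t=x_t+\sigma\zeta_t$, where $x\in\mathbb C^{\mathbb Z}$ is unknown, $\sigma\ge 0$, and $\zeta_t=\xi^1_t+i\xi^2_t$ with all $\xi^1_t,\xi^2_t$ independent standard real normal variables. A constrained least-squares filter on $[-N,N]$ is given by integers $a\le b$, $0\le k\le m$ with $-N\le a-(m-k)$, $b+k\le N$ and a real number $\varrho\ge1$, all fixed in advance: it is an optimal solution $\widehat\varphi$, supported on $[-k,m-k]$, of $$\min_{\varphi}\Big\{\sum_{t=a}^{b}|y_t-[\varphi*y]_t|^2:\ \sum_{l=0}^{m}\Big|\frac1{\sqrt{m+1}}\sum_{j=0}^m\varphi_{j-k}e^{2\pi i lj/(m+1)}\Big|\le\frac{\varrho}{\sqrt{m+1}}\Big\},$$ and it estimates $x_t$, $a\le t\le b$, by $[\widehat\varphi*y]_t$. An estimator combines $J$ such filters if at each point $t\in[-N,N]$ it equals the estimate given by one of the $J$ filters whose window $[a,b]$ contains $t$, the choice of this filter being fixed in advance. Put $\mathrm{MSE}=\mathbf E\sum_{|t|\le N}|x_t-\widehat x_t|^2$. There is an absolute constant $C>0$, and for every $u>1$ a constant $C_u>0$,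 such that for all integers $N\ge0$, $s\ge1$ there is a measurable estimator $\widehat x$ (a function of $(y_t)_{|t|\le N}$ which may depend on $N,s,u$, but not on $x$ or $\sigma$), combining at most $C\ln(N+2)$ constrained least-squares filters, with the following properties for all $\sigma\ge0$. (i) For every generalized harmonic oscillation with $s$ frequencies counted with multiplicity, i.e. $x_t=\sum_{k}\sum_{0\le j<m_k}c_{kj}t^je^{2\pi i f_kt}$ with real $f_k$, complex $c_{kj}$ and $\sum_k m_k=s$, $$\mathrm{MSE}\le C\sigma^2s^3\ln^2(N+2).$$ (ii) For every harmonic oscillation $x_t=\sum_{k=1}^sc_ke^{2\pi i f_kt}$ with well-separated frequencies, i.e. such that $N\,\delta(f_k-f_l)\ge u$, where $\delta(\cdot)$ is the distance to the nearest integer, for all $k\ne l$, $$\mathrm{MSE}\le C_u\sigma^2s^2\ln^2(N+2).$$ -/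

import Mathlib

open MeasureTheory ProbabilityTheory

/-- Two-sided complex-valued sequences. -/
abbrev Signal : Type := ℤ → ℂ

/-- The law of `ξ₁ + i ξ₂` with `ξ₁, ξ₂` independent real standard normal variables. -/
noncomputable def stdComplexGaussian : Measure ℂ :=
  ((gaussianReal 0 1).prod (gaussianReal 0 1)).map
    (fun p : ℝ × ℝ => (p.1 : ℂ) + (p.2 : ℂ) * Complex.I)

/-- `ζ` is an i.i.d. sequence of standard complex Gaussian variables. -/
def IsStdComplexNoise {Ω : Type*} [MeasurableSpace Ω] (P : Measure Ω) (ζ : ℤ → Ω → ℂ) : Prop :=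
  (∀ t, HasLaw (ζ t) stdComplexGaussian P) ∧ iIndepFun ζ P

/-- The unitary discrete Fourier transform on `ℂ^(m+1)`. -/
noncomputable def dftU {m : ℕ} (z : Fin (m + 1) → ℂ) (l : Fin (m + 1)) : ℂ :=
  ((Real.sqrt (m + 1) : ℝ) : ℂ)⁻¹ *
    ∑ t : Fin (m + 1),
      z t * Complex.exp (2 * Real.pi * Complex.I * ((l : ℕ) : ℂ) * ((t : ℕ) : ℂ) / ((m : ℂ) + 1))

/-- The convolution `[φ * y]_t = ∑_τ φ_τ y_{t-τ}` for a filter `φ` supported on `[-k, m-k]`,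
where `φ` is given by the vector `c` of its coefficients, `φ_{j-k} = c_j` for `0 ≤ j ≤ m`. -/
noncomputable def filterApply {m : ℕ} (k : ℕ) (c : Fin (m + 1) → ℂ) (y : Signal) (t : ℤ) : ℂ :=
  ∑ j : Fin (m + 1), c j * y (t - (((j : ℕ) : ℤ) - (k : ℤ)))

/-- The parameters of a constrained least-squares filter: the filter is supported on
`[-k, m-k]` (`k = 0`: left filter, `k = m`: right filter), it is fitted to the observations on
`[left, right]`, and the norm of its Fourier transform is bounded through `rho`. -/
structure LSProblem where
  left : ℤ
  right : ℤ
  m : ℕ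
  k : ℕ
  rho : ℝ

namespace LSProblem

/-- The problem makes sense and involves only the observations on `[-N, N]`. -/
def Admissible (w : LSProblem) (N : ℕ) : Prop :=
  w.left ≤ w.right ∧ w.k ≤ w.m ∧ 1 ≤ w.rho ∧
    -(N : ℤ) ≤ w.left - ((w.m : ℤ) - (w.k : ℤ)) ∧ w.right + (w.k : ℤ) ≤ (N : ℤ)

/-- The constraint: the `ℓ₁`-norm of the Fourier transform is at most `rho / √(m+1)`. -/
def Feasible (w : LSProblem) (c : Fin (w.m + 1) → ℂ) : Prop :=
  ∑ l : Fin (w.m + 1), ‖dftU c l‖ ≤ w.rho / Real.sqrt (w.m + 1)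

/-- The least-squares criterion `∑_{left ≤ t ≤ right} |y_t - [φ * y]_t|²`. -/
noncomputable def residual (w : LSProblem) (y : Signal) (c : Fin (w.m + 1) → ℂ) : ℝ :=
  ∑ t ∈ Finset.Icc w.left w.right, ‖y t - filterApply w.k c y t‖ ^ 2

/-- `c` is an optimal solution of the constrained least-squares problem for the data `y`. -/
def IsSolution (w : LSProblem) (y : Signal) (c : Fin (w.m + 1) → ℂ) : Prop :=
  w.Feasible c ∧ ∀ c', w.Feasible c' → w.residual y c ≤ w.residual y c'

end LSProblem

/-- `xhat` combines `J` constrained least-squares filters on `[-N, N]`: the problems `w i` and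
the assignment `piece` of points to problems are fixed in advance, `φ i y` is an optimal solution
of the `i`-th problem for the data `y`, and at each point `t` of `[-N, N]` the estimate of the
signal is the output of the filter number `piece t`, one of those fitted on a window
containing `t`. -/
def CombinesLSFilters (N J : ℕ) (xhat : Signal → Signal) : Prop :=
  ∃ (w : Fin J → LSProblem) (piece : Set.Icc (-(N : ℤ)) (N : ℤ) → Fin J)
    (φ : (i : Fin J) → Signal → (Fin ((w i).m + 1) → ℂ)),
    (∀ i, (w i).Admissible N) ∧
    (∀ i y, (w i).IsSolution y (φ i y)) ∧
    (∀ t : Set.Icc (-(N : ℤ)) (N : ℤ),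
      (t : ℤ) ∈ Set.Icc (w (piece t)).left (w (piece t)).right) ∧
    (∀ (y : Signal) (t : Set.Icc (-(N : ℤ)) (N : ℤ)),
      xhat y (t : ℤ) = filterApply (w (piece t)).k (φ (piece t) y) y (t : ℤ))

/-- An estimator of the signal from the observations `y_t`, `|t| ≤ N`. -/
def IsEstimator (N : ℕ) (xhat : Signal → Signal) : Prop :=
  Measurable xhat ∧ DependsOn xhat (Set.Icc (-(N : ℤ)) (N : ℤ))

/-- The observations `y_t = x_t + σ ζ_t`. -/
noncomputable def observe (x : Signal) (σ : ℝ) (z : Signal) : Signal :=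
  fun t => x t + (σ : ℂ) * z t

/-- The mean squared error `E ∑_{|t| ≤ N} |x_t - x̂_t|²`. -/
noncomputable def totalMSE {Ω : Type*} [MeasurableSpace Ω] (P : Measure Ω) (N : ℕ)
    (xhat : Signal → Signal) (x : Signal) (σ : ℝ) (ζ : ℤ → Ω → ℂ) : ENNReal :=
  ∫⁻ ω, ∑ t ∈ Finset.Icc (-(N : ℤ)) (N : ℤ),
    ‖x t - xhat (observe x σ (fun r => ζ r ω)) t‖ₑ ^ 2 ∂P

/-- Generalized harmonic oscillations with `s` frequencies counted with multiplicity: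
`x_t = ∑_k ∑_{j < mult k} c_{kj} t^j exp(2π i f_k t)` with real `f_k` and `∑_k mult k = s`. -/
def IsGenHarmonicOscillation (s : ℕ) (x : Signal) : Prop :=
  ∃ (r : ℕ) (f : Fin r → ℝ) (mult : Fin r → ℕ) (c : Fin r → ℕ → ℂ),
    ∑ k, mult k = s ∧
    ∀ t : ℤ, x t = ∑ k, ∑ j ∈ Finset.range (mult k),
      c k j * (t : ℂ) ^ j * Complex.exp (2 * Real.pi * Complex.I * (f k : ℂ) * (t : ℂ))

/-- Harmonic oscillations `x_t = ∑_{k=1}^s c_k exp(2π i f_k t)` whose frequencies are separated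
by at least `u / N` in the wrap-around distance of `ℝ / ℤ`. -/
def IsSeparatedHarmonicOscillation (u : ℝ) (N s : ℕ) (x : Signal) : Prop :=
  ∃ (f : Fin s → ℝ) (c : Fin s → ℂ),
    (∀ i j, i ≠ j → u ≤ (N : ℝ) * ‖((f i - f j : ℝ) : UnitAddCircle)‖) ∧
    ∀ t : ℤ, x t = ∑ k, c k * Complex.exp (2 * Real.pi * Complex.I * (f k : ℂ) * (t : ℂ))

/-! A generalized harmonic oscillation lies in a shift-invariant space `V` of dimension at most `s`,
and the proof works with `V` alone. It yields `σ² s² ln² N` on the whole class of (i), which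
contains the class of (ii); `s² ≤ s³` then gives (i).

Existence of a good filter: among the `n + 1` points of `[0, n]`, some diagonal entry of the
orthogonal projector on `V` is at most `s / (n + 1)`. The corresponding row, moved around by shifts,
is a filter `ψ` on `[-n, n]` with `ψ * x = x` on `V` and small energy. By Parseval, `ψ * ψ` is also
reproducing and its Fourier transform has `ℓ₁`-norm at most `4 s / √(m + 1)`
(`ShiftInvariant.exists_feasible`).

Risk on one window: comparing the least-squares solution with this filter bounds the error by three
noise terms (`LSProblem.IsSolution.oracle`). One is the projection of the noise on `V`, of order
`s`. The other two, the energy of the filtered noise and its correlation with the noise, are taken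
uniformly over feasible filters: by `ℓ₁`-`ℓ∞` duality only the `m + 1` exponential filters matter,
at the price of a logarithm. For the correlation, the window is so short that every moving sum
covers it. The quadratic form then splits into the square of a linear functional and a term pairing
the noise inside with independent noise outside. Each window costs `s² ln N`.

Near the ends of `[-N, N]` only short filters fit. Dyadic windows, with filter width comparable to
the distance to the boundary, cover the segment with `O(ln N)` filters, whence the second logarithm.
-/

section

/-! ### Bounds in mean, and exponential moments of linear functionals of the noise. -/

/-- The mean of (the positive part of) `f` is at most `b`. -/
def MeanLE {Ω : Type*} [MeasurableSpace Ω] (P : Measure Ω) (f : Ω → ℝ) (b : ℝ) : Prop :=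
  AEMeasurable f P ∧ ∫⁻ ω, ENNReal.ofReal (f ω) ∂P ≤ ENNReal.ofReal b

namespace MeanLE

variable {Ω : Type*} [MeasurableSpace Ω] {P : Measure Ω} {f g : Ω → ℝ} {b c : ℝ}

lemma mono (h : MeanLE P f b) (hbc : b ≤ c) : MeanLE P f c :=
  ⟨h.1, h.2.trans (ENNReal.ofReal_le_ofReal hbc)⟩

lemma of_le (h : MeanLE P f b) (hg : AEMeasurable g P) (hgf : ∀ ω, g ω ≤ f ω) : MeanLE P g b :=
  ⟨hg, (lintegral_mono fun ω => ENNReal.ofReal_le_ofReal (hgf ω)).trans h.2⟩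

lemma add (hf : MeanLE P f b) (hg : MeanLE P g c) (hb : 0 ≤ b) (hc : 0 ≤ c) :
    MeanLE P (fun ω => f ω + g ω) (b + c) := by
  refine ⟨hf.1.add hg.1, ?_⟩
  calc ∫⁻ ω, ENNReal.ofReal (f ω + g ω) ∂P
      ≤ ∫⁻ ω, (ENNReal.ofReal (f ω) + ENNReal.ofReal (g ω)) ∂P :=
        lintegral_mono fun ω => ENNReal.ofReal_add_le
    _ = ∫⁻ ω, ENNReal.ofReal (f ω) ∂P + ∫⁻ ω, ENNReal.ofReal (g ω) ∂P :=
        lintegral_add_left' hf.1.ennreal_ofReal _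
    _ ≤ ENNReal.ofReal (b + c) := by
        rw [ENNReal.ofReal_add hb hc]
        exact add_le_add hf.2 hg.2

lemma const_mul (hf : MeanLE P f b) {a : ℝ} (ha : 0 ≤ a) :
    MeanLE P (fun ω => a * f ω) (a * b) := by
  refine ⟨hf.1.const_mul a, ?_⟩
  simp_rw [ENNReal.ofReal_mul ha]
  rw [lintegral_const_mul' _ _ ENNReal.ofReal_ne_top]
  gcongr
  exact hf.2

lemma const [IsProbabilityMeasure P] (a : ℝ) : MeanLE P (fun _ => a) a :=
  ⟨aemeasurable_const, by simp⟩

lemma sum {ι : Type*} {F : ι → Ω → ℝ} (s : Finset ι) (h : ∀ i ∈ s, MeanLE P (F i) b)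
    (hb : 0 ≤ b) : MeanLE P (fun ω => ∑ i ∈ s, F i ω) (s.card * b) := by
  classical
  induction s using Finset.induction_on with
  | empty => exact ⟨by simp, by simp⟩
  | insert i s hi ih =>
    have h1 := (h i (Finset.mem_insert_self _ _)).add
      (ih fun j hj => h j (Finset.mem_insert_of_mem hj)) hb (by positivity)
    simp_rw [Finset.sum_insert hi, Finset.card_insert_of_notMem hi]
    exact h1.mono (by push_cast; linarith)

/-- The maximum of finitely many variables with bounded exponential moments has a mean of
logarithmic order. -/
lemma exists_sup [IsProbabilityMeasure P] {M : ℕ} (hM : 0 < M) {X : Fin M → Ω → ℝ} {K : ℝ}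
    (hK : 0 ≤ K) (h : ∀ l, MeanLE P (fun ω => Real.exp (X l ω)) K) :
    ∃ Y : Ω → ℝ, MeanLE P Y (Real.log M + K) ∧ ∀ ω l, X l ω ≤ Y ω := by
  have hM' : (0 : ℝ) < M := by exact_mod_cast hM
  -- Apply `v + 1 ≤ exp v` to `v = X l - log M` and bound `exp (X l)` by the sum over all indices.
  refine ⟨fun ω => Real.log M + (M : ℝ)⁻¹ * ∑ l, Real.exp (X l ω), ?_, fun ω l => ?_⟩
  · refine ((const (Real.log M)).add ((sum Finset.univ (fun l _ => h l) hK).const_mul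
      (inv_nonneg.2 hM'.le)) (Real.log_natCast_nonneg M) (by positivity)).mono ?_
    rw [Finset.card_univ, Fintype.card_fin, inv_mul_cancel_left₀ hM'.ne']
  · have h1 : Real.exp (X l ω) ≤ ∑ l, Real.exp (X l ω) :=
      Finset.single_le_sum (f := fun l => Real.exp (X l ω)) (fun _ _ => (Real.exp_pos _).le)
        (Finset.mem_univ l)
    have h2 := Real.add_one_le_exp (X l ω - Real.log M)
    rw [Real.exp_sub, Real.exp_log hM', div_eq_inv_mul] at h2
    have h3 := mul_le_mul_of_nonneg_left h1 (inv_nonneg.2 hM'.le)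
    linarith

end MeanLE

/-- The density turns the integrand into a multiple of `exp (-x² / 4)`; the exact value is `√2`. -/
lemma lintegral_exp_sq_gaussianReal :
    ∫⁻ x, ENNReal.ofReal (Real.exp (x ^ 2 / 4)) ∂(gaussianReal 0 1) ≤ ENNReal.ofReal 2 := by
  have hint : Integrable fun x : ℝ => (Real.sqrt (2 * Real.pi))⁻¹ * Real.exp (-(1 / 4) * x ^ 2) :=
    (integrable_exp_neg_mul_sq (by norm_num)).const_mul _
  rw [gaussianReal_of_var_ne_zero 0 one_ne_zero,
    lintegral_withDensity_eq_lintegral_mul _ (measurable_gaussianPDF 0 1) (by fun_prop)]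
  have h : ∀ x : ℝ, (gaussianPDF 0 1 * fun x => ENNReal.ofReal (Real.exp (x ^ 2 / 4))) x =
      ENNReal.ofReal ((Real.sqrt (2 * Real.pi))⁻¹ * Real.exp (-(1 / 4) * x ^ 2)) := by
    intro x
    rw [Pi.mul_apply, gaussianPDF_def, ← ENNReal.ofReal_mul (gaussianPDFReal_nonneg _ _ _),
      gaussianPDFReal_def]
    congr 1
    simp only [NNReal.coe_one, mul_one, sub_zero]
    rw [mul_assoc, ← Real.exp_add]
    ring_nf
  simp_rw [h]
  rw [← ofReal_integral_eq_lintegral_ofReal hint (Filter.Eventually.of_forall fun x => by positivity),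
    integral_const_mul, integral_gaussian]
  refine ENNReal.ofReal_le_ofReal ?_
  rw [inv_mul_le_iff₀ (by positivity), Real.sqrt_le_left (by positivity), mul_pow,
    Real.sq_sqrt (by positivity)]
  linarith [Real.pi_pos]

lemma lintegral_exp_sq_gaussianReal_of_le {v : NNReal} (hv : v ≤ 1) :
    ∫⁻ x, ENNReal.ofReal (Real.exp (x ^ 2 / 4)) ∂(gaussianReal 0 v) ≤ ENNReal.ofReal 2 := by
  have h := gaussianReal_map_const_mul (μ := 0) (v := 1) (Real.sqrt v)
  have h2 : (NNReal.mk (Real.sqrt v ^ 2) (sq_nonneg _) * 1 : NNReal) = v := by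
    ext; simp
  rw [h2, mul_zero] at h
  rw [← h, lintegral_map (by fun_prop) (by fun_prop)]
  refine (lintegral_mono fun x => ENNReal.ofReal_le_ofReal (Real.exp_le_exp.2 ?_)).trans
    lintegral_exp_sq_gaussianReal
  rw [mul_pow, Real.sq_sqrt v.coe_nonneg]
  have : (v : ℝ) ≤ 1 := by exact_mod_cast hv
  nlinarith [sq_nonneg x]

lemma map_re_mul_stdComplexGaussian (a : ℂ) :
    stdComplexGaussian.map (fun z => (a * z).re) = gaussianReal 0 (‖a‖₊ ^ 2) := by
  rw [stdComplexGaussian, Measure.map_map (by fun_prop) (by fun_prop)]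
  have h1 : HasLaw (fun p : ℝ × ℝ => a.re * p.1) (gaussianReal (a.re * 0)
      (NNReal.mk (a.re ^ 2) (sq_nonneg _) * 1)) ((gaussianReal 0 1).prod (gaussianReal 0 1)) :=
    gaussianReal_const_mul ⟨by fun_prop, by simp⟩ _
  have h2 : HasLaw (fun p : ℝ × ℝ => (-a.im) * p.2) (gaussianReal ((-a.im) * 0)
      (NNReal.mk ((-a.im) ^ 2) (sq_nonneg _) * 1)) ((gaussianReal 0 1).prod (gaussianReal 0 1)) :=
    gaussianReal_const_mul ⟨by fun_prop, by simp⟩ _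
  have h3 : IndepFun (fun p : ℝ × ℝ => a.re * p.1) (fun p : ℝ × ℝ => (-a.im) * p.2)
      ((gaussianReal 0 1).prod (gaussianReal 0 1)) :=
    indepFun_prod (by fun_prop) (by fun_prop)
  have h4 := gaussianReal_add_gaussianReal_of_indepFun h3 h1.map_eq h2.map_eq
  have h5 : ((fun z : ℂ => (a * z).re) ∘ fun p : ℝ × ℝ => (p.1 : ℂ) + (p.2 : ℂ) * Complex.I) =
      (fun p : ℝ × ℝ => a.re * p.1) + (fun p : ℝ × ℝ => (-a.im) * p.2) := by
    ext p
    simp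
    ring
  rw [h5, h4]
  congr 1
  · simp
  · ext
    simp [Complex.sq_norm, Complex.normSq_apply]
    ring

variable {Ω : Type*} [MeasurableSpace Ω] {P : Measure Ω} {ζ : ℤ → Ω → ℂ}

lemma IsStdComplexNoise.aemeasurable (hζ : IsStdComplexNoise P ζ) (t : ℤ) :
    AEMeasurable (ζ t) P := (hζ.1 t).aemeasurable

variable [IsProbabilityMeasure P]

lemma IsStdComplexNoise.hasLaw_re_sum (hζ : IsStdComplexNoise P ζ) (F : Finset ℤ) (a : ℤ → ℂ) :
    HasLaw (fun ω => ∑ r ∈ F, (a r * ζ r ω).re) (gaussianReal 0 (∑ r ∈ F, ‖a r‖₊ ^ 2)) P := by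
  classical
  have hm : ∀ r, AEMeasurable (fun ω => (a r * ζ r ω).re) P := fun r =>
    Complex.measurable_re.comp_aemeasurable ((hζ.aemeasurable r).const_mul _)
  induction F using Finset.induction_on with
  | empty =>
    refine ⟨by simp, ?_⟩
    simp
  | insert i s hi ih =>
    have h1 : HasLaw (fun ω => (a i * ζ i ω).re) (gaussianReal 0 (‖a i‖₊ ^ 2)) P :=
      HasLaw.comp (X := ζ i) (Y := fun z => (a i * z).re)
        ⟨by fun_prop, map_re_mul_stdComplexGaussian _⟩ (hζ.1 i)
    have hI : iIndepFun (fun r ω => (a r * ζ r ω).re) P :=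
      hζ.2.comp (fun r z => (a r * z).re) fun r => by fun_prop
    have h2 := (hI.indepFun_finsetSum_of_notMem₀ hm hi).symm
    have h2' : IndepFun (fun ω => (a i * ζ i ω).re) (fun ω => ∑ r ∈ s, (a r * ζ r ω).re) P := by
      convert h2 using 1
      ext ω
      simp
    have h3 := gaussianReal_add_gaussianReal_of_indepFun h2' h1.map_eq ih.map_eq
    refine ⟨Finset.aemeasurable_fun_sum _ fun r _ => hm r, ?_⟩
    rw [Finset.sum_insert hi, ← zero_add (0 : ℝ), ← h3]
    congr 1
    ext ω
    simp [Finset.sum_insert hi]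

lemma IsStdComplexNoise.lintegral_exp_re_sq (hζ : IsStdComplexNoise P ζ) (F : Finset ℤ)
    (a : ℤ → ℂ) (ha : ∑ r ∈ F, ‖a r‖ ^ 2 ≤ 1) :
    MeanLE P (fun ω => Real.exp ((∑ r ∈ F, a r * ζ r ω).re ^ 2 / 4)) 2 := by
  have h := hζ.hasLaw_re_sum F a
  simp_rw [Complex.re_sum]
  refine ⟨?_, ?_⟩
  · have := h.aemeasurable
    fun_prop
  · rw [h.lintegral_comp (f := fun x => ENNReal.ofReal (Real.exp (x ^ 2 / 4))) (by fun_prop)]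
    refine lintegral_exp_sq_gaussianReal_of_le ?_
    rw [← NNReal.coe_le_coe]
    push_cast
    exact ha

/-- A linear functional of the noise with a coefficient vector in the unit ball has a bounded
square-exponential moment. -/
lemma IsStdComplexNoise.meanLE_exp_sq (hζ : IsStdComplexNoise P ζ) (F : Finset ℤ)
    (a : ℤ → ℂ) (ha : ∑ r ∈ F, ‖a r‖ ^ 2 ≤ 1) :
    MeanLE P (fun ω => Real.exp (‖∑ r ∈ F, a r * ζ r ω‖ ^ 2 / 8)) 2 := by
  have h1 := hζ.lintegral_exp_re_sq F a ha
  -- Multiplying by `-i` makes the imaginary part a real part. The two are combined by `2pq ≤ p² +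
  -- q²`, which needs no independence between them.
  have h2 := hζ.lintegral_exp_re_sq F (fun r => -Complex.I * a r) (by simpa using ha)
  have h3 := (h1.add h2 (by norm_num) (by norm_num)).const_mul (a := 1 / 2) (by norm_num)
  refine (h3.of_le ?_ fun ω => ?_).mono (by norm_num)
  · have := hζ.aemeasurable
    fun_prop
  · simp_rw [mul_assoc, ← Finset.mul_sum]
    set S := ∑ r ∈ F, a r * ζ r ω
    have h4 : (-Complex.I * S).re = S.im := by simp
    rw [h4, Complex.sq_norm, Complex.normSq_apply]
    have h5 : Real.exp ((S.re * S.re + S.im * S.im) / 8) =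
        Real.exp (S.re ^ 2 / 8) * Real.exp (S.im ^ 2 / 8) := by
      rw [← Real.exp_add]; ring_nf
    have h6 : ∀ x : ℝ, Real.exp (x ^ 2 / 4) = Real.exp (x ^ 2 / 8) ^ 2 := by
      intro x
      rw [← Real.exp_nat_mul]; push_cast; ring_nf
    rw [h5, h6, h6]
    nlinarith [sq_nonneg (Real.exp (S.re ^ 2 / 8) - Real.exp (S.im ^ 2 / 8))]

/-- The same bound when the coefficients depend on an independent block of the noise. -/
lemma IsStdComplexNoise.meanLE_exp_sq_of_disjoint (hζ : IsStdComplexNoise P ζ) {F F' : Finset ℤ}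
    (hF : Disjoint F' F) (o : (F' → ℂ) → ℤ → ℂ) (ho : ∀ r, Measurable fun z => o z r)
    (hle : ∀ z, ∑ r ∈ F, ‖o z r‖ ^ 2 ≤ 1) :
    MeanLE P (fun ω => Real.exp (‖∑ r ∈ F, o (fun i => ζ i ω) r * ζ r ω‖ ^ 2 / 8)) 2 := by
  have hm := hζ.aemeasurable
  have hX : AEMeasurable (fun ω (i : F) => ζ i ω) P := aemeasurable_pi_lambda _ fun i => hm i
  have hY : AEMeasurable (fun ω (i : F') => ζ i ω) P := aemeasurable_pi_lambda _ fun i => hm i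
  have hind := hζ.2.indepFun_finset₀ F' F hF hm
  have hmap := hind.map_prod_eq_prod_map_map hY hX
  set G : (F' → ℂ) × (F → ℂ) → ENNReal := fun p =>
    ENNReal.ofReal (Real.exp (‖∑ r : F, o p.1 r * p.2 r‖ ^ 2 / 8)) with hG
  have hGm : Measurable G := by
    have : ∀ r : F, Measurable fun p : (F' → ℂ) × (F → ℂ) => o p.1 r := fun r =>
      (ho r).comp measurable_fst
    fun_prop
  have hconv : ∀ (z : F' → ℂ) ω, ∑ r ∈ F, o z r * ζ r ω = ∑ r : F, o z r * ζ r ω := fun z ω =>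
    (Finset.sum_coe_sort F fun r => o z r * ζ r ω).symm
  refine ⟨?_, ?_⟩
  · have : ∀ r, AEMeasurable (fun ω => o (fun i => ζ i ω) r) P := fun r =>
      (ho r).comp_aemeasurable hY
    fun_prop
  · have e1 : ∫⁻ ω, ENNReal.ofReal
        (Real.exp (‖∑ r ∈ F, o (fun i => ζ i ω) r * ζ r ω‖ ^ 2 / 8)) ∂P =
        ∫⁻ p, G p ∂(P.map fun ω => ((fun i : F' => ζ i ω), (fun i : F => ζ i ω))) := by
      rw [lintegral_map' hGm.aemeasurable (hY.prodMk hX)]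
      simp_rw [hconv, hG]
    have := Measure.isProbabilityMeasure_map hX
    have := Measure.isProbabilityMeasure_map hY
    -- By independence the joint law is a product; with the block `F'` frozen, the coefficients are
    -- deterministic and the previous lemma applies to the inner integral.
    rw [e1, hmap, lintegral_prod _ hGm.aemeasurable]
    calc ∫⁻ z, ∫⁻ x, G (z, x) ∂(P.map fun ω (i : F) => ζ i ω) ∂(P.map fun ω (i : F') => ζ i ω)
        ≤ ∫⁻ z, ENNReal.ofReal 2 ∂(P.map fun ω (i : F') => ζ i ω) := by
          refine lintegral_mono fun z => ?_
          dsimp only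
          rw [lintegral_map' (by fun_prop) hX]
          have := (hζ.meanLE_exp_sq F (o z) (hle z)).2
          simpa only [hconv] using this
      _ = ENNReal.ofReal 2 := by simp

/-- The second moment of a linear functional of the noise. -/
lemma IsStdComplexNoise.meanLE_sq (hζ : IsStdComplexNoise P ζ) (F : Finset ℤ)
    (a : ℤ → ℂ) (ha : ∑ r ∈ F, ‖a r‖ ^ 2 ≤ 1) :
    MeanLE P (fun ω => ‖∑ r ∈ F, a r * ζ r ω‖ ^ 2) 16 := by
  refine (((hζ.meanLE_exp_sq F a ha).const_mul (a := 8) (by norm_num)).of_le ?_ fun ω => ?_).mono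
    (by norm_num)
  · have := hζ.aemeasurable
    fun_prop
  · linarith [Real.add_one_le_exp (‖∑ r ∈ F, a r * ζ r ω‖ ^ 2 / 8)]

/-- The maximum of the squares of `M` linear functionals of the noise, with coefficients depending
on an independent block. -/
lemma IsStdComplexNoise.exists_sup_sq_of_disjoint (hζ : IsStdComplexNoise P ζ) {M : ℕ} (hM : 0 < M)
    {F F' : Finset ℤ} (hF : Disjoint F' F) (o : Fin M → (F' → ℂ) → ℤ → ℂ)
    (ho : ∀ l r, Measurable fun z => o l z r) (hle : ∀ l z, ∑ r ∈ F, ‖o l z r‖ ^ 2 ≤ 1) :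
    ∃ Y : Ω → ℝ, MeanLE P Y (8 * (Real.log M + 2)) ∧
      ∀ ω l, ‖∑ r ∈ F, o l (fun i => ζ i ω) r * ζ r ω‖ ^ 2 ≤ Y ω := by
  obtain ⟨Y, hY, h⟩ := MeanLE.exists_sup hM (by norm_num) fun l =>
    hζ.meanLE_exp_sq_of_disjoint hF (o l) (ho l) (hle l)
  exact ⟨fun ω => 8 * Y ω, hY.const_mul (by norm_num), fun ω l => by linarith [h ω l]⟩

/-- The maximum of the squares of `M` linear functionals of the noise. -/
lemma IsStdComplexNoise.exists_sup_sq (hζ : IsStdComplexNoise P ζ) {M : ℕ} (hM : 0 < M)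
    (F : Finset ℤ) (a : Fin M → ℤ → ℂ) {v : ℝ} (hv : 0 < v)
    (ha : ∀ l, ∑ r ∈ F, ‖a l r‖ ^ 2 ≤ v) :
    ∃ Y : Ω → ℝ, MeanLE P Y (8 * v * (Real.log M + 2)) ∧
      ∀ ω l, ‖∑ r ∈ F, a l r * ζ r ω‖ ^ 2 ≤ Y ω := by
  have hs : Real.sqrt v ^ 2 = v := Real.sq_sqrt hv.le
  have hs0 : 0 < Real.sqrt v := Real.sqrt_pos.2 hv
  obtain ⟨Y, hY, h⟩ := MeanLE.exists_sup hM (K := 2) (by norm_num) fun l =>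
    hζ.meanLE_exp_sq F (fun r => ((Real.sqrt v)⁻¹ : ℝ) * a l r) (by
      simp_rw [norm_mul, mul_pow, ← Finset.mul_sum]
      rw [Complex.norm_real, Real.norm_of_nonneg (by positivity), inv_pow, hs,
        inv_mul_le_iff₀ hv, mul_one]
      exact ha l)
  refine ⟨fun ω => 8 * v * Y ω, hY.const_mul (by positivity), fun ω l => ?_⟩
  have := h ω l
  simp_rw [mul_assoc, ← Finset.mul_sum, norm_mul, mul_pow] at this
  rw [Complex.norm_real, Real.norm_of_nonneg (by positivity), inv_pow, hs] at this
  rw [div_le_iff₀ (by norm_num), inv_mul_le_iff₀ hv] at this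
  linarith

end

/-! ### Shift-invariant signal spaces. -/

/-- The space of signals `V` is invariant under all shifts. -/
def ShiftInvariant (V : Submodule ℂ Signal) : Prop :=
  ∀ x ∈ V, ∀ d : ℤ, (fun t => x (t + d)) ∈ V

/-- Take the span of all `t^j exp(2πi f_k t)` with `j < mult k`. By the binomial theorem a shift
only produces lower powers at the same frequency. -/
lemma IsGenHarmonicOscillation.exists_shiftInvariant {s : ℕ} {x : Signal}
    (hx : IsGenHarmonicOscillation s x) :
    ∃ V : Submodule ℂ Signal, FiniteDimensional ℂ V ∧ Module.finrank ℂ V ≤ s ∧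
      ShiftInvariant V ∧ x ∈ V := by
  obtain ⟨r, f, mult, c, hs, hx⟩ := hx
  set e : (Σ k : Fin r, Fin (mult k)) → Signal := fun p t =>
    (t : ℂ) ^ (p.2 : ℕ) * Complex.exp (2 * Real.pi * Complex.I * (f p.1 : ℂ) * (t : ℂ)) with he
  have hmem : ∀ (k : Fin r) (j : ℕ), j < mult k → (fun t : ℤ => (t : ℂ) ^ j *
      Complex.exp (2 * Real.pi * Complex.I * (f k : ℂ) * (t : ℂ))) ∈
      Submodule.span ℂ (Set.range e) := fun k j hj =>
    Submodule.subset_span ⟨⟨k, ⟨j, hj⟩⟩, rfl⟩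
  refine ⟨Submodule.span ℂ (Set.range e), FiniteDimensional.span_of_finite ℂ (Set.finite_range e),
    ?_, ?_, ?_⟩
  · refine (finrank_range_le_card e).trans ?_
    simp [hs]
  · intro x hx d
    have hle : Submodule.span ℂ (Set.range e) ≤ (Submodule.span ℂ (Set.range e)).comap
        (LinearMap.funLeft ℂ ℂ (fun t : ℤ => t + d)) := by
      rw [Submodule.span_le]
      rintro _ ⟨⟨k, j⟩, rfl⟩
      have h : LinearMap.funLeft ℂ ℂ (fun t : ℤ => t + d) (e ⟨k, j⟩) =
          ∑ i ∈ Finset.range (j + 1), (((d : ℂ) ^ ((j : ℕ) - i) * ((j : ℕ).choose i : ℂ)) *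
            Complex.exp (2 * Real.pi * Complex.I * (f k : ℂ) * (d : ℂ))) •
            (fun t : ℤ => (t : ℂ) ^ i *
              Complex.exp (2 * Real.pi * Complex.I * (f k : ℂ) * (t : ℂ))) := by
        ext t
        simp only [LinearMap.funLeft_apply, he, Finset.sum_apply, Pi.smul_apply, smul_eq_mul]
        push_cast
        rw [add_pow, mul_add, Complex.exp_add, Finset.sum_mul]
        refine Finset.sum_congr rfl fun i _ => ?_
        ring
      rw [SetLike.mem_coe, Submodule.mem_comap, h]
      refine Submodule.sum_mem _ fun i hi => Submodule.smul_mem _ _ (hmem k i ?_)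
      have := j.2
      rw [Finset.mem_range] at hi
      omega
    exact hle hx
  · have h : x = ∑ k, ∑ j ∈ Finset.range (mult k), c k j • (fun t : ℤ => (t : ℂ) ^ j *
        Complex.exp (2 * Real.pi * Complex.I * (f k : ℂ) * (t : ℂ))) := by
      ext t
      rw [hx]
      simp only [Finset.sum_apply, Pi.smul_apply, smul_eq_mul, mul_assoc]
    rw [h]
    exact Submodule.sum_mem _ fun k _ => Submodule.sum_mem _ fun j hj =>
      Submodule.smul_mem _ _ (hmem k j (Finset.mem_range.1 hj))

lemma IsSeparatedHarmonicOscillation.isGen {u : ℝ} {N s : ℕ} {x : Signal}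
    (hx : IsSeparatedHarmonicOscillation u N s x) : IsGenHarmonicOscillation s x := by
  obtain ⟨f, c, -, hx⟩ := hx
  refine ⟨s, f, fun _ => 1, fun k _ => c k, by simp, fun t => ?_⟩
  rw [hx]
  simp

/-- An orthonormal basis of the restrictions of the signals of `V` to a finite window `F`. -/
lemma exists_orthonormal_window (V : Submodule ℂ Signal) [FiniteDimensional ℂ V] (F : Finset ℤ) :
    ∃ (d : ℕ) (b : Fin d → ℤ → ℂ), d ≤ Module.finrank ℂ V ∧
      (∀ i, ∑ t ∈ F, ‖b i t‖ ^ 2 = 1) ∧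
      (∀ x ∈ V, ∀ t ∈ F, x t = ∑ i, (∑ r ∈ F, starRingEnd ℂ (b i r) * x r) * b i t) ∧
      (∀ α : Fin d → ℂ, ∑ t ∈ F, ‖∑ i, α i * b i t‖ ^ 2 = ∑ i, ‖α i‖ ^ 2) := by
  set R : Signal →ₗ[ℂ] EuclideanSpace ℂ F :=
    (WithLp.linearEquiv 2 ℂ (F → ℂ)).symm.toLinearMap ∘ₗ LinearMap.funLeft ℂ ℂ (fun t : F => (t : ℤ))
    with hR
  have hRa : ∀ x t, R x t = x (t : ℤ) := fun x t => rfl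
  set W := V.map R with hW
  set b' := stdOrthonormalBasis ℂ W with hb'
  have hnorm : ∀ α : Fin (Module.finrank ℂ W) → ℂ,
      ∑ t ∈ F.attach, ‖∑ i, α i * (b' i : EuclideanSpace ℂ F) t‖ ^ 2 = ∑ i, ‖α i‖ ^ 2 := by
    intro α
    have h1 := b'.sum_sq_norm_inner_right (∑ i, α i • b' i)
    have h2 : ‖∑ i, α i • b' i‖ ^ 2 =
        ∑ t : F, ‖∑ i, α i * (b' i : EuclideanSpace ℂ F) t‖ ^ 2 := by
      rw [← Submodule.norm_coe, EuclideanSpace.norm_sq_eq]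
      simp
    rw [Finset.univ_eq_attach] at h2
    rw [← h2, ← h1]
    refine Finset.sum_congr rfl fun i _ => ?_
    rw [b'.orthonormal.inner_right_fintype]
  refine ⟨Module.finrank ℂ W, fun i t => if h : t ∈ F then (b' i : EuclideanSpace ℂ F) ⟨t, h⟩ else 0,
    Submodule.finrank_map_le _ _, ?_, ?_, ?_⟩
  · intro i
    have h := hnorm (Pi.single i 1)
    rw [← Finset.sum_attach]
    simp only [Finset.coe_mem, dif_pos]
    refine Eq.trans ?_ (h.trans ?_)
    · refine Finset.sum_congr rfl fun t _ => ?_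
      rw [Finset.sum_eq_single i]
      · simp
      · intro j _ hj; simp [hj]
      · simp
    · rw [Finset.sum_eq_single i]
      · simp
      · intro j _ hj; simp [hj]
      · simp
  · intro x hx t ht
    have hx' : R x ∈ W := Submodule.mem_map_of_mem hx
    have h := b'.sum_repr' ⟨R x, hx'⟩
    have h2 := congrArg (fun w : W => (w : EuclideanSpace ℂ F) ⟨t, ht⟩) h
    simp only [Submodule.coe_sum, Submodule.coe_smul, WithLp.ofLp_sum, WithLp.ofLp_smul,
      Finset.sum_apply, Pi.smul_apply, smul_eq_mul] at h2
    rw [hRa] at h2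
    rw [← h2]
    refine Finset.sum_congr rfl fun i _ => ?_
    simp only [dif_pos ht]
    congr 1
    rw [Submodule.coe_inner, PiLp.inner_apply, ← Finset.sum_attach F]
    simp [hRa, mul_comm]
  · intro α
    rw [← hnorm α, ← Finset.sum_attach]
    simp

/-! ### The discrete Fourier transform and duality for feasible filters. -/

/-- The primitive root of unity of order `m + 1` that defines the Fourier transform. -/
noncomputable def dftRoot (m : ℕ) : ℂ := Complex.exp (2 * Real.pi * Complex.I / ((m + 1 : ℕ) : ℂ))

lemma dftRoot_isPrimitiveRoot (m : ℕ) : IsPrimitiveRoot (dftRoot m) (m + 1) :=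
  Complex.isPrimitiveRoot_exp (m + 1) (Nat.succ_ne_zero m)

lemma norm_dftRoot (m : ℕ) : ‖dftRoot m‖ = 1 :=
  (dftRoot_isPrimitiveRoot m).norm'_eq_one (Nat.succ_ne_zero m)

lemma dftRoot_ne_zero (m : ℕ) : dftRoot m ≠ 0 := Complex.exp_ne_zero _

lemma norm_dftRoot_zpow (m : ℕ) (n : ℤ) : ‖dftRoot m ^ n‖ = 1 := by
  rw [norm_zpow, norm_dftRoot, one_zpow]

lemma dftU_eq {m : ℕ} (c : Fin (m + 1) → ℂ) (l : Fin (m + 1)) :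
    dftU c l = ((Real.sqrt (m + 1) : ℝ) : ℂ)⁻¹ *
      ∑ t : Fin (m + 1), c t * dftRoot m ^ (((l : ℕ) : ℤ) * ((t : ℕ) : ℤ)) := by
  rw [dftU]
  congr 1
  refine Finset.sum_congr rfl fun t _ => ?_
  rw [dftRoot, ← Complex.exp_int_mul]
  congr 2
  push_cast
  ring

lemma sum_dftRoot_zpow (m : ℕ) {d : ℤ} (h1 : -((m : ℤ) + 1) < d) (h2 : d < (m : ℤ) + 1) :
    ∑ l : Fin (m + 1), dftRoot m ^ (((l : ℕ) : ℤ) * d) = if d = 0 then ((m : ℂ) + 1) else 0 := by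
  split_ifs with hd
  · simp [hd]
  · have hne : dftRoot m ^ d ≠ 1 := by
      rw [Ne, (dftRoot_isPrimitiveRoot m).zpow_eq_one_iff_dvd]
      intro h
      have := Int.le_of_dvd (abs_pos.2 hd) ((dvd_abs _ _).2 h)
      push_cast at this
      have := abs_lt.2 ⟨h1, h2⟩
      omega
    have h : ∀ l : Fin (m + 1), dftRoot m ^ (((l : ℕ) : ℤ) * d) = (dftRoot m ^ d) ^ (l : ℕ) := by
      intro l
      rw [mul_comm, zpow_mul, zpow_natCast]
    simp_rw [h]
    rw [Fin.sum_univ_eq_sum_range (fun l => (dftRoot m ^ d) ^ l) (m + 1), geom_sum_eq hne,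
      ← zpow_natCast, zpow_comm, zpow_natCast, (dftRoot_isPrimitiveRoot m).pow_eq_one]
    simp

/-- Fourier inversion, from the orthogonality of the characters. -/
lemma sum_dftU_mul {m : ℕ} (c : Fin (m + 1) → ℂ) (j : Fin (m + 1)) :
    ((Real.sqrt (m + 1) : ℝ) : ℂ)⁻¹ *
      ∑ l : Fin (m + 1), dftU c l * dftRoot m ^ (-(((l : ℕ) : ℤ) * ((j : ℕ) : ℤ))) = c j := by
  have hs : ((Real.sqrt (m + 1) : ℝ) : ℂ) * ((Real.sqrt (m + 1) : ℝ) : ℂ) = (m : ℂ) + 1 := by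
    rw [← Complex.ofReal_mul, Real.mul_self_sqrt (by positivity)]
    push_cast; ring
  have hne : (m : ℂ) + 1 ≠ 0 := Nat.cast_add_one_ne_zero m
  have h : ∑ l : Fin (m + 1), (∑ t : Fin (m + 1), c t * dftRoot m ^ (((l : ℕ) : ℤ) * ((t : ℕ) : ℤ))) *
      dftRoot m ^ (-(((l : ℕ) : ℤ) * ((j : ℕ) : ℤ))) = ((m : ℂ) + 1) * c j := by
    simp_rw [Finset.sum_mul]
    rw [Finset.sum_comm]
    have h2 : ∀ t : Fin (m + 1), ∑ l : Fin (m + 1), c t * dftRoot m ^ (((l : ℕ) : ℤ) * ((t : ℕ) : ℤ)) *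
        dftRoot m ^ (-(((l : ℕ) : ℤ) * ((j : ℕ) : ℤ))) =
        c t * if t = j then ((m : ℂ) + 1) else 0 := by
      intro t
      have h3 := sum_dftRoot_zpow m (d := ((t : ℕ) : ℤ) - ((j : ℕ) : ℤ)) (by omega) (by omega)
      have h4 : (((t : ℕ) : ℤ) - ((j : ℕ) : ℤ) = 0) ↔ t = j := by
        rw [sub_eq_zero, Nat.cast_inj, Fin.ext_iff]
      simp only [h4] at h3
      rw [← h3, Finset.mul_sum]
      refine Finset.sum_congr rfl fun l _ => ?_
      rw [mul_assoc, ← zpow_add₀ (dftRoot_ne_zero m)]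
      congr 2
      ring
    simp_rw [h2]
    simp [mul_comm]
  simp_rw [dftU_eq, mul_assoc, ← Finset.mul_sum]
  rw [h, ← mul_assoc, ← mul_assoc, ← mul_inv, hs, inv_mul_cancel₀ hne, one_mul]

/-- A linear functional is bounded on the feasible filters by its values at the exponentials. -/
lemma LSProblem.Feasible.norm_sum_mul_le {w : LSProblem} {c : Fin (w.m + 1) → ℂ} (hc : w.Feasible c)
    (g : Fin (w.m + 1) → ℂ) {B : ℝ}
    (hB : ∀ l : Fin (w.m + 1), ‖∑ j : Fin (w.m + 1),
      dftRoot w.m ^ (-(((l : ℕ) : ℤ) * ((j : ℕ) : ℤ))) * g j‖ ≤ B) :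
    ‖∑ j, c j * g j‖ ≤ w.rho / (w.m + 1) * B := by
  have hB0 : 0 ≤ B := (norm_nonneg _).trans (hB 0)
  -- Inversion writes the filter as a combination of exponentials with weights `dftU c`; the
  -- constraint bounds the `ℓ₁`-norm of these weights.
  have h1 : ∑ j, c j * g j = ((Real.sqrt (w.m + 1) : ℝ) : ℂ)⁻¹ * ∑ l, dftU c l *
      ∑ j : Fin (w.m + 1), dftRoot w.m ^ (-(((l : ℕ) : ℤ) * ((j : ℕ) : ℤ))) * g j := by
    simp_rw [Finset.mul_sum]
    rw [Finset.sum_comm]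
    refine Finset.sum_congr rfl fun j _ => ?_
    rw [← sum_dftU_mul c j, Finset.mul_sum, Finset.sum_mul]
    refine Finset.sum_congr rfl fun l _ => ?_
    ring
  rw [h1, norm_mul, norm_inv, Complex.norm_real, Real.norm_of_nonneg (Real.sqrt_nonneg _)]
  have h2 : ‖∑ l, dftU c l * ∑ j : Fin (w.m + 1),
      dftRoot w.m ^ (-(((l : ℕ) : ℤ) * ((j : ℕ) : ℤ))) * g j‖ ≤
      w.rho / Real.sqrt (w.m + 1) * B := by
    refine (norm_sum_le _ _).trans ?_
    refine le_trans ?_ (mul_le_mul_of_nonneg_right hc hB0)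
    rw [Finset.sum_mul]
    refine Finset.sum_le_sum fun l _ => ?_
    rw [norm_mul]
    exact mul_le_mul_of_nonneg_left (hB l) (norm_nonneg _)
  calc (Real.sqrt (w.m + 1))⁻¹ * _ ≤ (Real.sqrt (w.m + 1))⁻¹ * (w.rho / Real.sqrt (w.m + 1) * B) :=
        mul_le_mul_of_nonneg_left h2 (by positivity)
    _ = w.rho / (Real.sqrt (w.m + 1) * Real.sqrt (w.m + 1)) * B := by
        field_simp
    _ = w.rho / (w.m + 1) * B := by rw [Real.mul_self_sqrt (by positivity)]

/-- An exponential filter acts as a modulated moving sum. -/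
lemma sum_dftRoot_mul_eq {m : ℕ} (k : ℕ) (l : ℕ) (y : Signal) (t : ℤ) :
    ∑ j : Fin (m + 1), dftRoot m ^ (-((l : ℤ) * ((j : ℕ) : ℤ))) * y (t - (((j : ℕ) : ℤ) - (k : ℤ))) =
      dftRoot m ^ (-((l : ℤ) * (t + k))) *
        ∑ r ∈ Finset.Icc (t + k - m) (t + k), dftRoot m ^ ((l : ℤ) * r) * y r := by
  rw [Finset.mul_sum, Fin.sum_univ_eq_sum_range (fun j => dftRoot m ^ (-((l : ℤ) * (j : ℤ))) *
    y (t - ((j : ℤ) - (k : ℤ)))) (m + 1)]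
  refine Finset.sum_bij' (fun j _ => t + k - (j : ℤ)) (fun r _ => (t + k - r).toNat) ?_ ?_ ?_ ?_ ?_
  · intro j hj
    rw [Finset.mem_range] at hj
    rw [Finset.mem_Icc]
    omega
  · intro r hr
    rw [Finset.mem_Icc] at hr
    rw [Finset.mem_range]
    omega
  · intro j hj
    simp
  · intro r hr
    rw [Finset.mem_Icc] at hr
    omega
  · intro j hj
    rw [← mul_assoc, ← zpow_add₀ (dftRoot_ne_zero m)]
    congr 2
    · ring
    · ring

/-! ### Feasible filters that reproduce a shift-invariant space. -/

lemma sum_Icc_neg_ite_sub {n : ℕ} {j : ℤ} (hj : j ∈ Finset.Icc (0 : ℤ) n) {E : Type*}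
    [AddCommMonoid E] (G : ℤ → E) :
    ∑ τ ∈ Finset.Icc (-(n : ℤ)) n, (if j - τ ∈ Finset.Icc (0 : ℤ) n then G (j - τ) else 0) =
      ∑ r ∈ Finset.Icc (0 : ℤ) n, G r := by
  rw [← Finset.sum_filter]
  rw [Finset.mem_Icc] at hj
  refine Finset.sum_bij' (fun τ _ => j - τ) (fun r _ => j - r) ?_ ?_ ?_ ?_ ?_
  · intro τ hτ
    exact (Finset.mem_filter.1 hτ).2
  · intro r hr
    rw [Finset.mem_filter]
    simp only [Finset.mem_Icc] at hr ⊢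
    omega
  · intros; ring
  · intros; ring
  · intros; rfl

/-- A shift-invariant space of dimension at most `s` is reproduced by a two-sided filter on
`[-n, n]` of squared norm at most `s / (n + 1)`. -/
lemma ShiftInvariant.exists_reproducing {V : Submodule ℂ Signal} [FiniteDimensional ℂ V]
    (hV : ShiftInvariant V) {s : ℕ} (hs : Module.finrank ℂ V ≤ s) (n : ℕ) :
    ∃ ψ : ℤ → ℂ, ∑ τ ∈ Finset.Icc (-(n : ℤ)) n, ‖ψ τ‖ ^ 2 ≤ s / (n + 1) ∧
      ∀ x ∈ V, ∀ t, ∑ τ ∈ Finset.Icc (-(n : ℤ)) n, ψ τ * x (t - τ) = x t := by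
  obtain ⟨d, b, hd, h1, hrep, hnorm⟩ := exists_orthonormal_window V (Finset.Icc (0 : ℤ) n)
  -- The diagonal of the projection kernel sums to `d ≤ s` over `n + 1` points, so some entry is at
  -- most the average.
  obtain ⟨j, hj, hjs⟩ : ∃ j ∈ Finset.Icc (0 : ℤ) n, ∑ i, ‖b i j‖ ^ 2 ≤ (s : ℝ) / (n + 1) := by
    refine Finset.exists_le_of_sum_le ⟨0, by simp⟩ ?_
    rw [Finset.sum_comm, Finset.sum_congr rfl fun i _ => h1 i]
    simp only [Finset.sum_const, Finset.card_univ, Fintype.card_fin, Int.card_Icc, nsmul_eq_mul]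
    have : (((n : ℤ) + 1 - 0).toNat : ℝ) = n + 1 := by
      have : ((n : ℤ) + 1 - 0).toNat = n + 1 := by omega
      rw [this]; push_cast; ring
    rw [this, mul_div_cancel₀ _ (by positivity), mul_one]
    exact_mod_cast hd.trans hs
  -- Row `j` of the projection kernel: pairing it with `x ∈ V` returns `x j`, and its squared norm
  -- is the diagonal entry at `j`. Reflected about `j` it becomes a convolution filter.
  set α : ℤ → ℂ := fun r => ∑ i, starRingEnd ℂ (b i r) * b i j with hα
  refine ⟨fun τ => if j - τ ∈ Finset.Icc (0 : ℤ) n then α (j - τ) else 0, ?_, ?_⟩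
  · have h2 : ∀ τ, ‖(if j - τ ∈ Finset.Icc (0 : ℤ) n then α (j - τ) else 0)‖ ^ 2 =
        if j - τ ∈ Finset.Icc (0 : ℤ) n then ‖α (j - τ)‖ ^ 2 else 0 := by
      intro τ; split_ifs <;> simp
    simp_rw [h2]
    rw [sum_Icc_neg_ite_sub hj fun r => ‖α r‖ ^ 2]
    have h3 := hnorm fun i => starRingEnd ℂ (b i j)
    simp only [RCLike.norm_conj] at h3
    rw [← h3] at hjs
    refine le_trans (le_of_eq ?_) hjs
    refine Finset.sum_congr rfl fun r _ => ?_
    rw [← RCLike.norm_conj (α r), hα, map_sum]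
    simp [mul_comm]
  · intro x hx t
    have h2 : ∀ τ, (if j - τ ∈ Finset.Icc (0 : ℤ) n then α (j - τ) else 0) * x (t - τ) =
        if j - τ ∈ Finset.Icc (0 : ℤ) n then α (j - τ) * x ((j - τ) + (t - j)) else 0 := by
      intro τ
      split_ifs
      · congr 2; ring
      · simp
    simp_rw [h2]
    rw [sum_Icc_neg_ite_sub hj fun r => α r * x (r + (t - j))]
    -- Shift invariance transports the identity at the single point `j` to every `t`.
    have h3 := hrep _ (hV x hx (t - j)) j hj
    rw [show j + (t - j) = t by ring] at h3
    rw [h3]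
    simp_rw [hα, Finset.sum_mul]
    rw [Finset.sum_comm]
    refine Finset.sum_congr rfl fun i _ => Finset.sum_congr rfl fun r _ => ?_
    ring

/-- The problem with a symmetric filter on `[-h, h]` fitted on `[a, b]`. -/
def symProblem (a b : ℤ) (h s : ℕ) : LSProblem := ⟨a, b, 2 * h, h, 4 * s⟩

/-- The coefficients of the filter `ψ * ψ` on `[-h, h]`, where `ψ` is supported on `[-n, n]`. -/
noncomputable def autoConv (h n : ℕ) (ψ : ℤ → ℂ) (j : Fin (2 * h + 1)) : ℂ :=
  ∑ p ∈ Finset.Icc (-(n : ℤ)) n, ∑ q ∈ Finset.Icc (-(n : ℤ)) n,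
    if p + q + h = ((j : ℕ) : ℤ) then ψ p * ψ q else 0

/-- With `2 * n ≤ h` every index `p + q + h` falls in `[0, 2h]`, so no product `ψ p * ψ q` is lost.
-/
lemma sum_autoConv_mul {h n : ℕ} (hn : 2 * n ≤ h) (ψ : ℤ → ℂ) (G : ℤ → ℂ) :
    ∑ j : Fin (2 * h + 1), autoConv h n ψ j * G ((j : ℕ) : ℤ) =
      ∑ p ∈ Finset.Icc (-(n : ℤ)) n, ∑ q ∈ Finset.Icc (-(n : ℤ)) n,
        ψ p * ψ q * G (p + q + h) := by
  simp_rw [autoConv, Finset.sum_mul]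
  rw [Finset.sum_comm]
  refine Finset.sum_congr rfl fun p hp => ?_
  rw [Finset.sum_comm]
  refine Finset.sum_congr rfl fun q hq => ?_
  rw [Finset.mem_Icc] at hp hq
  have hlt : (p + q + h).toNat < 2 * h + 1 := by omega
  rw [Finset.sum_eq_single ⟨(p + q + h).toNat, hlt⟩]
  · have : (((p + q + h).toNat : ℕ) : ℤ) = p + q + h := Int.toNat_of_nonneg (by omega)
    simp [this]
  · intro j _ hj
    rw [if_neg, zero_mul]
    intro h'
    apply hj
    ext
    simp [h']
  · simp

/-- Parseval: as `2 * n ≤ m`, the points of `[-n, n]` are distinct modulo `m + 1`. -/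
lemma sum_sq_norm_trigPoly {m n : ℕ} (hn : 2 * n ≤ m) (ψ : ℤ → ℂ) :
    ∑ l : Fin (m + 1), ‖∑ p ∈ Finset.Icc (-(n : ℤ)) n, ψ p * dftRoot m ^ (((l : ℕ) : ℤ) * p)‖ ^ 2 =
      (m + 1) * ∑ p ∈ Finset.Icc (-(n : ℤ)) n, ‖ψ p‖ ^ 2 := by
  have hconj : ∀ k : ℤ, starRingEnd ℂ (dftRoot m ^ k) = dftRoot m ^ (-k) := by
    intro k
    rw [zpow_neg, Complex.inv_eq_conj (norm_dftRoot_zpow m k)]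
  have key : ∑ l : Fin (m + 1), ((∑ p ∈ Finset.Icc (-(n : ℤ)) n,
      ψ p * dftRoot m ^ (((l : ℕ) : ℤ) * p)) * starRingEnd ℂ (∑ p ∈ Finset.Icc (-(n : ℤ)) n,
      ψ p * dftRoot m ^ (((l : ℕ) : ℤ) * p))) =
      ((m : ℂ) + 1) * ∑ p ∈ Finset.Icc (-(n : ℤ)) n, ψ p * starRingEnd ℂ (ψ p) := by
    simp_rw [map_sum, map_mul, hconj, Finset.sum_mul_sum]
    rw [Finset.sum_comm, Finset.mul_sum]
    refine Finset.sum_congr rfl fun p hp => ?_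
    rw [Finset.sum_comm]
    have h2 : ∀ q ∈ Finset.Icc (-(n : ℤ)) n, ∑ l : Fin (m + 1),
        (ψ p * dftRoot m ^ (((l : ℕ) : ℤ) * p) *
          (starRingEnd ℂ (ψ q) * dftRoot m ^ (-(((l : ℕ) : ℤ) * q)))) =
        if p = q then ψ p * starRingEnd ℂ (ψ q) * ((m : ℂ) + 1) else 0 := by
      intro q hq
      rw [Finset.mem_Icc] at hp hq
      have h3 := sum_dftRoot_zpow m (d := p - q) (by omega) (by omega)
      simp only [sub_eq_zero] at h3
      rw [← mul_ite_zero, ← h3, Finset.mul_sum]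
      refine Finset.sum_congr rfl fun l _ => ?_
      rw [mul_mul_mul_comm, ← zpow_add₀ (dftRoot_ne_zero m)]
      congr 2
      ring
    rw [Finset.sum_congr rfl h2, Finset.sum_ite_eq, if_pos hp]
    ring
  simp_rw [Complex.mul_conj'] at key
  exact_mod_cast key

/-- A shift-invariant space is reproduced by a feasible symmetric filter. -/
lemma ShiftInvariant.exists_feasible {V : Submodule ℂ Signal} [FiniteDimensional ℂ V]
    (hV : ShiftInvariant V) {s : ℕ} (hs : Module.finrank ℂ V ≤ s) (a b : ℤ) (h : ℕ) :
    ∃ c, (symProblem a b h s).Feasible c ∧ ∀ x ∈ V, ∀ t, filterApply h c x t = x t := by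
  obtain ⟨ψ, hψ, hrep⟩ := hV.exists_reproducing hs (h / 2)
  have hn : 2 * (h / 2) ≤ h := Nat.mul_div_le h 2
  set n := h / 2 with hnd
  refine ⟨autoConv h n ψ, ?_, ?_⟩
  · have h1 : ∀ l : Fin (2 * h + 1), ‖dftU (autoConv h n ψ) l‖ =
        (Real.sqrt ((2 * h : ℕ) + 1))⁻¹ *
        ‖∑ p ∈ Finset.Icc (-(n : ℤ)) n, ψ p * dftRoot (2 * h) ^ (((l : ℕ) : ℤ) * p)‖ ^ 2 := by
      intro l
      rw [dftU_eq, sum_autoConv_mul hn ψ fun j => dftRoot (2 * h) ^ (((l : ℕ) : ℤ) * j)]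
      have h2 : ∑ p ∈ Finset.Icc (-(n : ℤ)) n, ∑ q ∈ Finset.Icc (-(n : ℤ)) n,
          ψ p * ψ q * dftRoot (2 * h) ^ (((l : ℕ) : ℤ) * (p + q + h)) =
          dftRoot (2 * h) ^ (((l : ℕ) : ℤ) * h) *
          (∑ p ∈ Finset.Icc (-(n : ℤ)) n, ψ p * dftRoot (2 * h) ^ (((l : ℕ) : ℤ) * p)) ^ 2 := by
        rw [sq, Finset.sum_mul_sum, Finset.mul_sum]
        refine Finset.sum_congr rfl fun p _ => ?_
        rw [Finset.mul_sum]
        refine Finset.sum_congr rfl fun q _ => ?_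
        rw [mul_add, mul_add, zpow_add₀ (dftRoot_ne_zero _), zpow_add₀ (dftRoot_ne_zero _)]
        ring
      rw [h2, norm_mul, norm_mul, norm_dftRoot_zpow, one_mul, norm_pow, norm_inv,
        Complex.norm_real, Real.norm_of_nonneg (Real.sqrt_nonneg _)]
    change ∑ l : Fin (2 * h + 1), ‖dftU (autoConv h n ψ) l‖ ≤
      (4 * s : ℝ) / Real.sqrt ((2 * h : ℕ) + 1)
    simp_rw [h1]
    rw [← Finset.mul_sum, sum_sq_norm_trigPoly (by omega), div_eq_inv_mul]
    refine mul_le_mul_of_nonneg_left ?_ (by positivity)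
    -- Source of `rho = 4 s`: with `n = ⌊h / 2⌋` the energy bound `s / (n + 1)` is multiplied by `2h
    -- + 1 ≤ 4 (n + 1)`.
    have h3 : (((2 * h : ℕ) : ℝ) + 1) ≤ 4 * ((n : ℝ) + 1) := by
      have : 2 * h + 1 ≤ 4 * (n + 1) := by omega
      exact_mod_cast this
    calc (((2 * h : ℕ) : ℝ) + 1) * ∑ p ∈ Finset.Icc (-(n : ℤ)) n, ‖ψ p‖ ^ 2
        ≤ 4 * ((n : ℝ) + 1) * (s / (n + 1)) := by gcongr
      _ = 4 * s := by field_simp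
  · intro x hx t
    change ∑ j : Fin (2 * h + 1), autoConv h n ψ j * x (t - (((j : ℕ) : ℤ) - (h : ℤ))) = x t
    rw [sum_autoConv_mul hn ψ fun j => x (t - (j - h))]
    rw [← hrep x hx t]
    refine Finset.sum_congr rfl fun p _ => ?_
    rw [← hrep x hx (t - p), Finset.mul_sum]
    refine Finset.sum_congr rfl fun q _ => ?_
    rw [mul_assoc]
    congr 3
    ring

/-! ### The deterministic oracle inequality. -/

lemma filterApply_observe {m : ℕ} (k : ℕ) (c : Fin (m + 1) → ℂ) (x z : Signal) (σ : ℝ) (t : ℤ) :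
    filterApply k c (observe x σ z) t = filterApply k c x t + σ * filterApply k c z t := by
  simp only [filterApply, observe, mul_add, Finset.sum_add_distrib, Finset.mul_sum]
  congr 1
  refine Finset.sum_congr rfl fun j _ => ?_
  ring

lemma ShiftInvariant.filterApply_mem {V : Submodule ℂ Signal} (hV : ShiftInvariant V) {m : ℕ}
    (k : ℕ) (c : Fin (m + 1) → ℂ) {x : Signal} (hx : x ∈ V) : filterApply k c x ∈ V := by
  have h : filterApply k c x =
      ∑ j : Fin (m + 1), c j • fun t => x (t + -(((j : ℕ) : ℤ) - (k : ℤ))) := by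
    ext t
    simp [filterApply, sub_eq_add_neg]
  rw [h]
  exact Submodule.sum_mem _ fun j _ => Submodule.smul_mem _ _ (hV x hx _)

lemma sum_norm_add_mul_sq (F : Finset ℤ) (e z : ℤ → ℂ) (σ : ℝ) :
    ∑ t ∈ F, ‖e t + σ * z t‖ ^ 2 = ∑ t ∈ F, ‖e t‖ ^ 2 +
      2 * σ * (∑ t ∈ F, starRingEnd ℂ (z t) * e t).re + σ ^ 2 * ∑ t ∈ F, ‖z t‖ ^ 2 := by
  rw [Complex.re_sum, Finset.mul_sum, Finset.mul_sum, ← Finset.sum_add_distrib,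
    ← Finset.sum_add_distrib]
  refine Finset.sum_congr rfl fun t _ => ?_
  simp only [Complex.sq_norm, Complex.normSq_apply, Complex.add_re, Complex.add_im, Complex.mul_re,
    Complex.mul_im, Complex.ofReal_re, Complex.ofReal_im, Complex.conj_re, Complex.conj_im]
  ring

/-- The oracle inequality for constrained least-squares filters, for a given realization `z` of the
noise: the squared error is controlled by the size of the filtered noise, its correlation with the
noise, and the projection of the noise on the signal space. -/
lemma LSProblem.IsSolution.oracle {V : Submodule ℂ Signal} (hV : ShiftInvariant V)
    {w : LSProblem} {x z : Signal} {σ : ℝ} (hσ : 0 ≤ σ) (hx : x ∈ V) {c c₀ : Fin (w.m + 1) → ℂ}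
    (hc : w.IsSolution (observe x σ z) c) (hc₀ : w.Feasible c₀)
    (hrep : ∀ t, filterApply w.k c₀ x t = x t) {A G B : ℝ}
    (hA : ∀ c', w.Feasible c' →
      ∑ t ∈ Finset.Icc w.left w.right, ‖filterApply w.k c' z t‖ ^ 2 ≤ A)
    (hG : ∀ c', w.Feasible c' →
      ‖∑ t ∈ Finset.Icc w.left w.right, starRingEnd ℂ (z t) * filterApply w.k c' z t‖ ≤ G)
    (hB : ∀ v ∈ V, ‖∑ t ∈ Finset.Icc w.left w.right, starRingEnd ℂ (z t) * v t‖ ^ 2 ≤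
      B * ∑ t ∈ Finset.Icc w.left w.right, ‖v t‖ ^ 2) (hB0 : 0 ≤ B) :
    ∑ t ∈ Finset.Icc w.left w.right, ‖x t - filterApply w.k c (observe x σ z) t‖ ^ 2 ≤
      σ ^ 2 * (3 * A + 8 * G + 8 * B) := by
  set F := Finset.Icc w.left w.right with hF
  set e : Signal := fun t => x t - filterApply w.k c (observe x σ z) t with he
  -- The bias of the fitted filter stays in `V` although the filter depends on the noise; its
  -- correlation with the noise is therefore governed by a projection on a fixed space.
  set v : Signal := x - filterApply w.k c x with hv
  have hvV : v ∈ V := Submodule.sub_mem _ hx (hV.filterApply_mem _ _ hx)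
  have hev : ∀ t, e t = v t - σ * filterApply w.k c z t := by
    intro t
    simp only [he, hv, Pi.sub_apply, filterApply_observe]
    ring
  -- Optimality against `c₀`, which leaves no bias. Once expanded, `σ² ∑ ‖z t‖²` cancels on both
  -- sides.
  have h1 : ∑ t ∈ F, ‖e t + σ * z t‖ ^ 2 ≤
      ∑ t ∈ F, ‖(-(σ * filterApply w.k c₀ z t)) + σ * z t‖ ^ 2 := by
    have h := hc.2 c₀ hc₀
    simp only [LSProblem.residual] at h
    refine le_trans (le_of_eq ?_) (h.trans (le_of_eq ?_))
    · refine Finset.sum_congr rfl fun t _ => ?_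
      simp only [he, observe]
      congr 2
      ring
    · refine Finset.sum_congr rfl fun t _ => ?_
      rw [filterApply_observe, hrep, observe]
      congr 2
      ring
  rw [sum_norm_add_mul_sq, sum_norm_add_mul_sq] at h1
  have h2 : ∑ t ∈ F, ‖-(σ * filterApply w.k c₀ z t)‖ ^ 2 ≤ σ ^ 2 * A := by
    simp_rw [norm_neg, norm_mul, mul_pow, ← Finset.mul_sum, Complex.norm_real, Real.norm_eq_abs,
      sq_abs]
    exact mul_le_mul_of_nonneg_left (hA c₀ hc₀) (sq_nonneg _)
  have h3 : (∑ t ∈ F, starRingEnd ℂ (z t) * -(σ * filterApply w.k c₀ z t)).re ≤ σ * G := by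
    have : ∑ t ∈ F, starRingEnd ℂ (z t) * -(σ * filterApply w.k c₀ z t) =
        -(σ * ∑ t ∈ F, starRingEnd ℂ (z t) * filterApply w.k c₀ z t) := by
      rw [Finset.mul_sum, ← Finset.sum_neg_distrib]
      exact Finset.sum_congr rfl fun t _ => by ring
    rw [this]
    refine (Complex.re_le_norm _).trans ?_
    rw [norm_neg, norm_mul, Complex.norm_real, Real.norm_of_nonneg hσ]
    exact mul_le_mul_of_nonneg_left (hG c₀ hc₀) hσ
  set p := ‖∑ t ∈ F, starRingEnd ℂ (z t) * v t‖ with hp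
  have h4 : -(p + σ * G) ≤ (∑ t ∈ F, starRingEnd ℂ (z t) * e t).re := by
    have : ∑ t ∈ F, starRingEnd ℂ (z t) * e t = ∑ t ∈ F, starRingEnd ℂ (z t) * v t -
        σ * ∑ t ∈ F, starRingEnd ℂ (z t) * filterApply w.k c z t := by
      rw [Finset.mul_sum, ← Finset.sum_sub_distrib]
      exact Finset.sum_congr rfl fun t _ => by rw [hev]; ring
    rw [neg_le, ← Complex.neg_re, this]
    refine (Complex.re_le_norm _).trans ?_
    rw [norm_neg]
    refine (norm_sub_le _ _).trans ?_
    rw [norm_mul, Complex.norm_real, Real.norm_of_nonneg hσ]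
    gcongr
    exact hG c hc.1
  have h5 : ∑ t ∈ F, ‖v t‖ ^ 2 ≤ 2 * ∑ t ∈ F, ‖e t‖ ^ 2 + 2 * σ ^ 2 * A := by
    have : ∑ t ∈ F, ‖v t‖ ^ 2 ≤
        ∑ t ∈ F, (2 * ‖e t‖ ^ 2 + 2 * σ ^ 2 * ‖filterApply w.k c z t‖ ^ 2) := by
      refine Finset.sum_le_sum fun t _ => ?_
      have h : ‖v t‖ ≤ ‖e t‖ + σ * ‖filterApply w.k c z t‖ := by
        have : v t = e t + σ * filterApply w.k c z t := by rw [hev]; ring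
        rw [this]
        refine (norm_add_le _ _).trans ?_
        rw [norm_mul, Complex.norm_real, Real.norm_of_nonneg hσ]
      nlinarith [norm_nonneg (v t), sq_nonneg (‖e t‖ - σ * ‖filterApply w.k c z t‖)]
    refine this.trans ?_
    rw [Finset.sum_add_distrib, ← Finset.mul_sum, ← Finset.mul_sum]
    have := mul_le_mul_of_nonneg_left (hA c hc.1) (by positivity : 0 ≤ 2 * σ ^ 2)
    linarith
  set D := ∑ t ∈ F, ‖e t‖ ^ 2 with hD
  have hD0 : 0 ≤ D := Finset.sum_nonneg fun t _ => sq_nonneg _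
  have h6 : p ^ 2 ≤ B * (2 * D + 2 * σ ^ 2 * A) :=
    (hB v hvV).trans (mul_le_mul_of_nonneg_left h5 hB0)
  have hA0 : 0 ≤ A := (Finset.sum_nonneg fun t _ => sq_nonneg _).trans (hA c hc.1)
  -- Young's inequality with weights leaving `D / 2`, which is absorbed on the left; doubling the
  -- rest gives the constants 3, 8, 8.
  have h7 : 2 * σ * p ≤ 4 * σ ^ 2 * B + (2 * D + 2 * σ ^ 2 * A) / 4 := by
    refine abs_le_of_sq_le_sq' ?_ (by positivity) |>.2
    have h8 : 0 ≤ 2 * D + 2 * σ ^ 2 * A := by positivity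
    have h9 := mul_le_mul_of_nonneg_left h6 (by positivity : 0 ≤ 4 * σ ^ 2)
    nlinarith [sq_nonneg (4 * σ ^ 2 * B - (2 * D + 2 * σ ^ 2 * A) / 4)]
  have h10 := mul_le_mul_of_nonneg_left h3 (by positivity : 0 ≤ 2 * σ)
  have h11 := mul_le_mul_of_nonneg_left h4 (by positivity : 0 ≤ 2 * σ)
  change D ≤ _
  nlinarith

/-! ### Noise terms, uniformly over feasible filters. -/

/-- The projection of the noise on the restrictions of the signals of `V` to a window `F`. -/
lemma IsStdComplexNoise.exists_projection_bound {Ω : Type*} [MeasurableSpace Ω] {P : Measure Ω}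
    [IsProbabilityMeasure P] {ζ : ℤ → Ω → ℂ} (hζ : IsStdComplexNoise P ζ)
    (V : Submodule ℂ Signal) [FiniteDimensional ℂ V] {s : ℕ} (hs : Module.finrank ℂ V ≤ s)
    (F : Finset ℤ) :
    ∃ B : Ω → ℝ, MeanLE P B (16 * s) ∧ ∀ ω, 0 ≤ B ω ∧ ∀ v ∈ V,
      ‖∑ t ∈ F, starRingEnd ℂ (ζ t ω) * v t‖ ^ 2 ≤ B ω * ∑ t ∈ F, ‖v t‖ ^ 2 := by
  obtain ⟨d, b, hd, h1, hrep, hnorm⟩ := exists_orthonormal_window V F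
  refine ⟨fun ω => ∑ i, ‖∑ t ∈ F, starRingEnd ℂ (b i t) * ζ t ω‖ ^ 2, ?_, fun ω => ⟨by positivity, ?_⟩⟩
  · refine (MeanLE.sum Finset.univ (fun i _ => hζ.meanLE_sq F (fun t => starRingEnd ℂ (b i t))
      (by simp [h1 i])) (by norm_num)).mono ?_
    have : (d : ℝ) ≤ s := by exact_mod_cast hd.trans hs
    simp
    linarith
  · intro v hv
    set β : Fin d → ℂ := fun i => ∑ r ∈ F, starRingEnd ℂ (b i r) * v r with hβ
    have h2 : ∑ t ∈ F, ‖v t‖ ^ 2 = ∑ i, ‖β i‖ ^ 2 := by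
      rw [← hnorm β]
      exact Finset.sum_congr rfl fun t ht => by rw [hrep v hv t ht]
    have h3 : ∑ t ∈ F, starRingEnd ℂ (ζ t ω) * v t =
        ∑ i, starRingEnd ℂ (∑ t ∈ F, starRingEnd ℂ (b i t) * ζ t ω) * β i := by
      simp_rw [map_sum, map_mul, Complex.conj_conj, Finset.sum_mul]
      rw [Finset.sum_comm]
      refine Finset.sum_congr rfl fun t ht => ?_
      rw [hrep v hv t ht, Finset.mul_sum]
      refine Finset.sum_congr rfl fun i _ => ?_
      ring
    rw [h2, h3]
    calc ‖∑ i, starRingEnd ℂ (∑ t ∈ F, starRingEnd ℂ (b i t) * ζ t ω) * β i‖ ^ 2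
        ≤ (∑ i, ‖∑ t ∈ F, starRingEnd ℂ (b i t) * ζ t ω‖ * ‖β i‖) ^ 2 := by
          gcongr
          refine (norm_sum_le _ _).trans (le_of_eq ?_)
          simp only [norm_mul, RCLike.norm_conj]
      _ ≤ _ := Finset.sum_mul_sq_le_sq_mul_sq _ _ _

section

variable {Ω : Type*} [MeasurableSpace Ω] {P : Measure Ω} [IsProbabilityMeasure P] {ζ : ℤ → Ω → ℂ}

/-- The energy of the filtered noise, uniformly over the feasible filters. -/
lemma IsStdComplexNoise.exists_energy_bound (hζ : IsStdComplexNoise P ζ) (a b : ℤ) (h s : ℕ)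
    (hab : b - a ≤ h) :
    ∃ A : Ω → ℝ, MeanLE P A (128 * s ^ 2 * (Real.log (2 * h + 1 : ℕ) + 2)) ∧
      ∀ ω c', (symProblem a b h s).Feasible c' →
        ∑ t ∈ Finset.Icc a b, ‖filterApply h c' (fun r => ζ r ω) t‖ ^ 2 ≤ A ω := by
  have hM : 0 < 2 * h + 1 := by omega
  have hM' : (0 : ℝ) < (2 * h + 1 : ℕ) := by exact_mod_cast hM
  have hL : 0 ≤ Real.log (2 * h + 1 : ℕ) := Real.log_natCast_nonneg _
  have hY : ∀ t : ℤ, ∃ Y : Ω → ℝ,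
      MeanLE P Y (8 * (2 * h + 1 : ℕ) * (Real.log (2 * h + 1 : ℕ) + 2)) ∧
      ∀ ω (l : Fin (2 * h + 1)), ‖∑ r ∈ Finset.Icc (t - h) (t + h),
        dftRoot (2 * h) ^ (((l : ℕ) : ℤ) * r) * ζ r ω‖ ^ 2 ≤ Y ω := by
    intro t
    refine hζ.exists_sup_sq hM _ (fun l r => dftRoot (2 * h) ^ (((l : ℕ) : ℤ) * r)) hM' fun l => ?_
    simp only [norm_dftRoot_zpow, one_pow, Finset.sum_const, Int.card_Icc, nsmul_eq_mul, mul_one]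
    rw [Nat.cast_le]
    omega
  choose Y hYm hYle using hY
  -- The factor is `rho / (m + 1)` squared, with `m = 2h`. The moving sums have second moments of
  -- order `2h + 1` and the window has at most `2h + 1` points, so the length cancels.
  refine ⟨fun ω => (4 * s / (2 * h + 1 : ℕ)) ^ 2 * ∑ t ∈ Finset.Icc a b, Y t ω, ?_, fun ω c' hc' => ?_⟩
  · refine ((MeanLE.sum _ (fun t _ => hYm t) (by positivity)).const_mul (by positivity)).mono ?_
    have hcard : ((Finset.Icc a b).card : ℝ) ≤ (2 * h + 1 : ℕ) := by
      rw [Nat.cast_le, Int.card_Icc]; omega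
    calc (4 * s / (2 * h + 1 : ℕ) : ℝ) ^ 2 * ((Finset.Icc a b).card *
          (8 * (2 * h + 1 : ℕ) * (Real.log (2 * h + 1 : ℕ) + 2)))
        ≤ (4 * s / (2 * h + 1 : ℕ) : ℝ) ^ 2 * ((2 * h + 1 : ℕ) *
          (8 * (2 * h + 1 : ℕ) * (Real.log (2 * h + 1 : ℕ) + 2))) := by gcongr
      _ = _ := by field_simp; ring
  · beta_reduce
    rw [Finset.mul_sum]
    refine Finset.sum_le_sum fun t _ => ?_
    have hY0 : 0 ≤ Y t ω := (sq_nonneg _).trans (hYle t ω 0)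
    have h1 := hc'.norm_sum_mul_le (fun j => ζ (t - (((j : ℕ) : ℤ) - (h : ℤ))) ω)
      (B := Real.sqrt (Y t ω)) fun l => by
        have h2 := sum_dftRoot_mul_eq (m := 2 * h) h l (fun r => ζ r ω) t
        have h3 : t + (h : ℤ) - ((2 * h : ℕ) : ℤ) = t - h := by push_cast; ring
        rw [h3] at h2
        refine Real.le_sqrt_of_sq_le (le_trans (le_of_eq ?_) (hYle t ω l))
        refine congrArg (· ^ 2) ((congrArg norm h2).trans ?_)
        rw [norm_mul, norm_dftRoot_zpow, one_mul]
    have h4 : ‖filterApply h c' (fun r => ζ r ω) t‖ ≤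
        4 * s / (2 * h + 1 : ℕ) * Real.sqrt (Y t ω) := by
      push_cast
      refine h1.trans (le_of_eq ?_)
      simp [symProblem]
    calc _ ≤ (4 * s / (2 * h + 1 : ℕ) * Real.sqrt (Y t ω)) ^ 2 := by gcongr
      _ = _ := by rw [mul_pow, Real.sq_sqrt hY0]

/-- The contribution of the points outside `[a, b]` to the moving sum over `[t - h, t + h]`. -/
noncomputable def outerSum (a b : ℤ) (h : ℕ) (η : ℤ → ℂ) (t : ℤ) : ℂ :=
  ∑ r ∈ Finset.Icc (t - h) (t + h) \ Finset.Icc a b, η r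

/-- Since `b - a ≤ h`, each `[t - h, t + h]` with `t ∈ [a, b]` contains `[a, b]`. The inner parts
give `|∑ η|²`; the outer parts give a linear form in the inner `η`, normalized in `h3` to unit
coefficients. In the application `y₂` is of order `M² ln M` and `y₃` of order `ln M`; the weight `M`
balances them. -/
lemma norm_sum_conj_mul_movingSum_le {a b : ℤ} {h : ℕ} (hab : b - a ≤ h) (η : ℤ → ℂ) {M y₁ y₂ y₃ : ℝ}
    (hM : 0 < M) (h1 : ‖∑ t ∈ Finset.Icc a b, η t‖ ^ 2 ≤ y₁)
    (h2 : ∑ t ∈ Finset.Icc a b, ‖outerSum a b h η t‖ ^ 2 ≤ y₂)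
    (h3 : ‖∑ t ∈ Finset.Icc a b, starRingEnd ℂ (outerSum a b h η t) /
      (Real.sqrt (∑ t ∈ Finset.Icc a b, ‖outerSum a b h η t‖ ^ 2) : ℝ) * η t‖ ^ 2 ≤ y₃) :
    ‖∑ t ∈ Finset.Icc a b, starRingEnd ℂ (η t) * ∑ r ∈ Finset.Icc (t - h) (t + h), η r‖ ≤
      y₁ + (y₂ / M + M * y₃) / 2 := by
  set F := Finset.Icc a b with hF
  set q := Real.sqrt (∑ t ∈ F, ‖outerSum a b h η t‖ ^ 2) with hq
  have hq2 : q ^ 2 = ∑ t ∈ F, ‖outerSum a b h η t‖ ^ 2 :=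
    Real.sq_sqrt (Finset.sum_nonneg fun _ _ => sq_nonneg _)
  have hq0 : 0 ≤ q := Real.sqrt_nonneg _
  have e1 : ∑ t ∈ F, starRingEnd ℂ (η t) * ∑ r ∈ Finset.Icc (t - h) (t + h), η r =
      starRingEnd ℂ (∑ t ∈ F, η t) * ∑ t ∈ F, η t +
        starRingEnd ℂ (∑ t ∈ F, starRingEnd ℂ (outerSum a b h η t) * η t) := by
    rw [map_sum, map_sum, Finset.sum_mul, ← Finset.sum_add_distrib]
    refine Finset.sum_congr rfl fun t ht => ?_
    have hsub : F ⊆ Finset.Icc (t - h) (t + h) := by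
      rw [Finset.mem_Icc] at ht
      exact Finset.Icc_subset_Icc (by omega) (by omega)
    rw [← Finset.sum_sdiff hsub, map_mul, Complex.conj_conj, outerSum]
    ring
  have e2 : ∑ t ∈ F, starRingEnd ℂ (outerSum a b h η t) * η t =
      q * ∑ t ∈ F, starRingEnd ℂ (outerSum a b h η t) / (q : ℝ) * η t := by
    rw [Finset.mul_sum]
    refine Finset.sum_congr rfl fun t ht => ?_
    -- If `q = 0`, all outer sums vanish and the quotient `0 / 0 = 0` does no harm.
    rcases eq_or_ne q 0 with h0 | h0
    · have : ‖outerSum a b h η t‖ ^ 2 = 0 := by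
        rw [h0, sq, mul_zero] at hq2
        exact (Finset.sum_eq_zero_iff_of_nonneg fun _ _ => sq_nonneg _).1 hq2.symm t ht
      simp [norm_eq_zero.1 (pow_eq_zero_iff two_ne_zero |>.1 this)]
    · have : (q : ℂ) ≠ 0 := by exact_mod_cast h0
      field_simp
  rw [e1]
  refine (norm_add_le _ _).trans (add_le_add ?_ ?_)
  · rw [norm_mul, RCLike.norm_conj, ← sq]
    exact h1
  · rw [RCLike.norm_conj, e2, norm_mul, Complex.norm_real, Real.norm_of_nonneg hq0]
    set p := ‖∑ t ∈ F, starRingEnd ℂ (outerSum a b h η t) / (q : ℝ) * η t‖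
    have h4 : q ^ 2 / M + M * p ^ 2 ≤ y₂ / M + M * y₃ := by
      rw [hq2]
      gcongr
    have h5 : q ^ 2 / M + M * p ^ 2 - 2 * (q * p) = (q - M * p) ^ 2 / M := by
      field_simp
      ring
    have h6 : 0 ≤ (q - M * p) ^ 2 / M := by positivity
    linarith

/-- Quadratic forms of the modulated noise with a band matrix. -/
lemma IsStdComplexNoise.exists_quadratic_bound (hζ : IsStdComplexNoise P ζ) (a b : ℤ) (h : ℕ)
    (hab : b - a ≤ h) :
    ∃ Y : Ω → ℝ, MeanLE P Y (16 * (2 * h + 1 : ℕ) * (Real.log (2 * h + 1 : ℕ) + 2)) ∧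
      ∀ ω (l : Fin (2 * h + 1)),
        ‖∑ t ∈ Finset.Icc a b, starRingEnd ℂ (dftRoot (2 * h) ^ (((l : ℕ) : ℤ) * t) * ζ t ω) *
          ∑ r ∈ Finset.Icc (t - h) (t + h), dftRoot (2 * h) ^ (((l : ℕ) : ℤ) * r) * ζ r ω‖ ≤
          Y ω := by
  have hM : 0 < 2 * h + 1 := by omega
  set M : ℝ := ((2 * h + 1 : ℕ) : ℝ) with hMdef
  have hM' : 0 < M := by rw [hMdef]; exact_mod_cast hM
  have hL : 0 ≤ Real.log M := Real.log_natCast_nonneg _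
  have hcard : ((Finset.Icc a b).card : ℝ) ≤ M := by
    rw [hMdef, Nat.cast_le, Int.card_Icc]; omega
  set e : Fin (2 * h + 1) → ℤ → ℂ := fun l r => dftRoot (2 * h) ^ (((l : ℕ) : ℤ) * r) with he
  have hen : ∀ l r, ‖e l r‖ = 1 := fun l r => norm_dftRoot_zpow _ _
  obtain ⟨Y₁, hY₁, hY₁le⟩ := hζ.exists_sup_sq hM (Finset.Icc a b) e hM' fun l => by
    simpa [hen] using hcard
  have hY : ∀ t : ℤ, ∃ Y : Ω → ℝ, MeanLE P Y (8 * M * (Real.log M + 2)) ∧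
      ∀ ω l, ‖outerSum a b h (fun r => e l r * ζ r ω) t‖ ^ 2 ≤ Y ω := by
    intro t
    refine hζ.exists_sup_sq hM _ e hM' fun l => ?_
    simp only [hen, one_pow, Finset.sum_const, nsmul_eq_mul, mul_one]
    rw [hMdef, Nat.cast_le]
    refine (Finset.card_le_card Finset.sdiff_subset).trans ?_
    rw [Int.card_Icc]
    omega
  choose Y₂ hY₂ hY₂le using hY
  set F' := Finset.Icc (a - h) (b + h) \ Finset.Icc a b with hF'
  let ext : (F' → ℂ) → ℤ → ℂ := fun z r => if hr : r ∈ F' then z ⟨r, hr⟩ else 0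
  have hext : ∀ r, Measurable fun z => ext z r := by
    intro r
    by_cases hr : r ∈ F'
    · simp only [ext, dif_pos hr]; fun_prop
    · simp only [ext, dif_neg hr]; fun_prop
  let O : Fin (2 * h + 1) → (F' → ℂ) → ℤ → ℂ := fun l z t =>
    outerSum a b h (fun r => e l r * ext z r) t
  have hO : ∀ l t, Measurable fun z => O l z t := by
    intro l t
    simp only [O, outerSum]
    fun_prop
  -- Normalized coefficients that are functions of the noise outside `[a, b]` only, hence
  -- independent of the noise they multiply.
  let o : Fin (2 * h + 1) → (F' → ℂ) → ℤ → ℂ := fun l z t =>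
    starRingEnd ℂ (O l z t) / (Real.sqrt (∑ t ∈ Finset.Icc a b, ‖O l z t‖ ^ 2) : ℝ) * e l t
  have hOext : ∀ ω l, ∀ t ∈ Finset.Icc a b, O l (fun i => ζ i ω) t =
      outerSum a b h (fun r => e l r * ζ r ω) t := by
    intro ω l t ht
    refine Finset.sum_congr rfl fun r hr => ?_
    have hr' : r ∈ F' := by
      simp only [hF', Finset.mem_sdiff, Finset.mem_Icc] at hr ht ⊢
      omega
    simp only [ext, dif_pos hr']
  obtain ⟨Y₃, hY₃, hY₃le⟩ := hζ.exists_sup_sq_of_disjoint hM (F := Finset.Icc a b) (F' := F')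
    Finset.sdiff_disjoint o (by
      intro l r
      have h1 := hO l r
      have h2 : Measurable fun z => (Real.sqrt (∑ t ∈ Finset.Icc a b, ‖O l z t‖ ^ 2) : ℂ) := by
        have := hO l
        fun_prop
      exact (((Complex.continuous_conj.measurable.comp h1).div h2)).mul_const _) (by
      intro l z
      simp only [o, norm_mul, norm_div, RCLike.norm_conj, hen, mul_one, div_pow,
        ← Finset.sum_div, Complex.norm_real, Real.norm_eq_abs, sq_abs]
      rw [Real.sq_sqrt (Finset.sum_nonneg fun _ _ => sq_nonneg _)]
      exact div_self_le_one _)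
  refine ⟨fun ω => Y₁ ω + ((∑ t ∈ Finset.Icc a b, Y₂ t ω) * (1 / M) + M * Y₃ ω) * (1 / 2), ?_,
    fun ω l => ?_⟩
  · have hS := MeanLE.sum (Finset.Icc a b) (fun t _ => hY₂ t) (by positivity)
    have h1 := ((hS.const_mul (a := 1 / M) (by positivity)).add (hY₃.const_mul hM'.le)
      (by positivity) (by positivity)).const_mul (a := 1 / 2) (by norm_num)
    have h2 := hY₁.add h1 (by positivity) (by positivity)
    refine (h2.of_le ?_ fun ω => le_of_eq (by ring)).mono ?_
    · exact h2.1.congr (Filter.Eventually.of_forall fun ω => by ring)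
    · have : 1 / M * ((Finset.Icc a b).card * (8 * M * (Real.log M + 2))) ≤
          1 / M * (M * (8 * M * (Real.log M + 2))) := by gcongr
      have h3 : 1 / M * (M * (8 * M * (Real.log M + 2))) = 8 * M * (Real.log M + 2) := by
        field_simp
      linarith
  · have h1 := norm_sum_conj_mul_movingSum_le hab (fun r => e l r * ζ r ω) hM' (hY₁le ω l)
      (Finset.sum_le_sum fun t _ => hY₂le t ω l) (y₃ := Y₃ ω) (by
        refine le_trans (le_of_eq ?_) (hY₃le ω l)
        have hs : ∑ t ∈ Finset.Icc a b, ‖O l (fun i => ζ i ω) t‖ ^ 2 =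
            ∑ t ∈ Finset.Icc a b, ‖outerSum a b h (fun r => e l r * ζ r ω) t‖ ^ 2 :=
          Finset.sum_congr rfl fun t ht => by rw [hOext ω l t ht]
        congr 2
        refine Finset.sum_congr rfl fun t ht => ?_
        simp only [o]
        rw [hOext ω l t ht, hs]
        ring)
    refine h1.trans (le_of_eq ?_)
    ring

/-- The correlation of the noise with the filtered noise, uniformly over the feasible filters. -/
lemma IsStdComplexNoise.exists_correlation_bound (hζ : IsStdComplexNoise P ζ) (a b : ℤ) (h s : ℕ)
    (hab : b - a ≤ h) :
    ∃ G : Ω → ℝ, MeanLE P G (64 * s * (Real.log (2 * h + 1 : ℕ) + 2)) ∧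
      ∀ ω c', (symProblem a b h s).Feasible c' →
        ‖∑ t ∈ Finset.Icc a b, starRingEnd ℂ (ζ t ω) *
          filterApply h c' (fun r => ζ r ω) t‖ ≤ G ω := by
  have hM' : (0 : ℝ) < (2 * h + 1 : ℕ) := by positivity
  obtain ⟨Y, hY, hYle⟩ := hζ.exists_quadratic_bound a b h hab
  refine ⟨fun ω => 4 * s / (2 * h + 1 : ℕ) * Y ω, (hY.const_mul (by positivity)).mono ?_,
    fun ω c' hc' => ?_⟩
  · refine le_of_eq ?_
    field_simp
    ring
  · have h1 := hc'.norm_sum_mul_le (fun j => ∑ t ∈ Finset.Icc a b, starRingEnd ℂ (ζ t ω) *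
      ζ (t - (((j : ℕ) : ℤ) - (h : ℤ))) ω) (B := Y ω) fun l => by
        refine le_trans (le_of_eq ?_) (hYle ω l)
        have e1 : ∀ t : ℤ, ∑ j : Fin (2 * h + 1), dftRoot (2 * h) ^ (-(((l : ℕ) : ℤ) * ((j : ℕ) : ℤ))) *
            (starRingEnd ℂ (ζ t ω) * ζ (t - (((j : ℕ) : ℤ) - (h : ℤ))) ω) =
            dftRoot (2 * h) ^ (-(((l : ℕ) : ℤ) * h)) *
            (starRingEnd ℂ (dftRoot (2 * h) ^ (((l : ℕ) : ℤ) * t) * ζ t ω) *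
            ∑ r ∈ Finset.Icc (t - h) (t + h), dftRoot (2 * h) ^ (((l : ℕ) : ℤ) * r) * ζ r ω) := by
          intro t
          have h2 := sum_dftRoot_mul_eq (m := 2 * h) h l (fun r => ζ r ω) t
          have h3 : t + (h : ℤ) - ((2 * h : ℕ) : ℤ) = t - h := by push_cast; ring
          rw [h3] at h2
          have h4 : starRingEnd ℂ (dftRoot (2 * h) ^ (((l : ℕ) : ℤ) * t)) =
              dftRoot (2 * h) ^ (-(((l : ℕ) : ℤ) * t)) := by
            rw [zpow_neg, Complex.inv_eq_conj (norm_dftRoot_zpow _ _)]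
          simp_rw [mul_left_comm _ (starRingEnd ℂ (ζ t ω))]
          rw [← Finset.mul_sum, h2, map_mul, h4, mul_add, neg_add,
            zpow_add₀ (dftRoot_ne_zero _)]
          ring
        have e2 : ∑ j : Fin (2 * h + 1), dftRoot (2 * h) ^ (-(((l : ℕ) : ℤ) * ((j : ℕ) : ℤ))) *
            ∑ t ∈ Finset.Icc a b, starRingEnd ℂ (ζ t ω) * ζ (t - (((j : ℕ) : ℤ) - (h : ℤ))) ω =
            dftRoot (2 * h) ^ (-(((l : ℕ) : ℤ) * h)) * ∑ t ∈ Finset.Icc a b,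
            (starRingEnd ℂ (dftRoot (2 * h) ^ (((l : ℕ) : ℤ) * t) * ζ t ω) *
            ∑ r ∈ Finset.Icc (t - h) (t + h), dftRoot (2 * h) ^ (((l : ℕ) : ℤ) * r) * ζ r ω) := by
          simp_rw [Finset.mul_sum (Finset.Icc a b)]
          rw [Finset.sum_comm]
          exact Finset.sum_congr rfl fun t _ => e1 t
        refine (congrArg norm e2).trans ?_
        rw [norm_mul, norm_dftRoot_zpow, one_mul]
    have e3 : ∑ t ∈ Finset.Icc a b, starRingEnd ℂ (ζ t ω) * filterApply h c' (fun r => ζ r ω) t =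
        ∑ j : Fin (2 * h + 1), c' j * ∑ t ∈ Finset.Icc a b, starRingEnd ℂ (ζ t ω) *
          ζ (t - (((j : ℕ) : ℤ) - (h : ℤ))) ω := by
      simp_rw [Finset.mul_sum (Finset.Icc a b)]
      rw [Finset.sum_comm]
      refine Finset.sum_congr rfl fun t _ => ?_
      change starRingEnd ℂ (ζ t ω) * ∑ j : Fin (2 * h + 1), c' j * _ = _
      rw [Finset.mul_sum]
      exact Finset.sum_congr rfl fun j _ => by ring
    rw [e3]
    refine h1.trans (le_of_eq ?_)
    simp [symProblem]

end

/-! ### Measurable selection of optimal solutions. -/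

/-- The sum of squares of the moduli of the coordinates. -/
noncomputable def coordSq {n : ℕ} (c : Fin n → ℂ) : ℝ := ∑ i, ‖c i‖ ^ 2

lemma continuous_coordSq {n : ℕ} : Continuous (coordSq (n := n)) := by
  unfold coordSq
  fun_prop

lemma coordSq_midpoint {n : ℕ} (c c' : Fin n → ℂ) :
    coordSq (fun i => (c i + c' i) / 2) + coordSq (c - c') / 4 = (coordSq c + coordSq c') / 2 := by
  simp only [coordSq, Finset.sum_div, ← Finset.sum_add_distrib, Pi.sub_apply]
  refine Finset.sum_congr rfl fun i _ => ?_
  have h := parallelogram_law_with_norm ℝ (c i) (c' i)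
  rw [norm_div, Complex.norm_ofNat]
  nlinarith

lemma eq_of_coordSq_sub_le_zero {n : ℕ} {c c' : Fin n → ℂ} (h : coordSq (c - c') ≤ 0) : c = c' := by
  ext i
  have h1 : ‖(c - c') i‖ ^ 2 ≤ coordSq (c - c') :=
    Finset.single_le_sum (f := fun i => ‖(c - c') i‖ ^ 2) (fun _ _ => sq_nonneg _)
      (Finset.mem_univ i)
  have h2 : ‖(c - c') i‖ ^ 2 = 0 := le_antisymm (h1.trans h) (sq_nonneg _)
  exact sub_eq_zero.1 (norm_eq_zero.1 (pow_eq_zero_iff two_ne_zero |>.1 h2))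

/-- Closed under midpoints. -/
def MidpointClosed {n : ℕ} (K : Set (Fin n → ℂ)) : Prop :=
  ∀ c ∈ K, ∀ c' ∈ K, (fun i => (c i + c' i) / 2) ∈ K

/-- Midpoint convex on a set. -/
def MidpointConvexOn {n : ℕ} (K : Set (Fin n → ℂ)) (f : (Fin n → ℂ) → ℝ) : Prop :=
  ∀ c ∈ K, ∀ c' ∈ K, f (fun i => (c i + c' i) / 2) ≤ (f c + f c') / 2

lemma exists_argmin_regularized {n : ℕ} {K : Set (Fin n → ℂ)} (hK : IsCompact K)
    (hne : K.Nonempty) {f : (Fin n → ℂ) → ℝ} (hf : Continuous f) (ε : ℝ) :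
    ∃ c ∈ K, ∀ c' ∈ K, f c + ε * coordSq c ≤ f c' + ε * coordSq c' := by
  obtain ⟨c, hc, h⟩ := hK.exists_isMinOn hne
    (f := fun c => f c + ε * coordSq c) (hf.add (continuous_const.mul continuous_coordSq)).continuousOn
  exact ⟨c, hc, fun c' hc' => h hc'⟩

/-- By the parallelogram identity `coordSq_midpoint`, the midpoint of two distinct minimizers would
do strictly better. -/
lemma argmin_regularized_unique {n : ℕ} {K : Set (Fin n → ℂ)} (hmid : MidpointClosed K)
    {f : (Fin n → ℂ) → ℝ} (hf : MidpointConvexOn K f) {ε : ℝ} (hε : 0 < ε) {c d : Fin n → ℂ}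
    (hc : c ∈ K) (hd : d ∈ K)
    (hcmin : ∀ c' ∈ K, f c + ε * coordSq c ≤ f c' + ε * coordSq c')
    (hdmin : ∀ c' ∈ K, f d + ε * coordSq d ≤ f c' + ε * coordSq c') : c = d := by
  refine eq_of_coordSq_sub_le_zero ?_
  have h1 := hcmin _ (hmid c hc d hd)
  have h2 := hdmin _ (hmid c hc d hd)
  have h3 := hf c hc d hd
  have h4 := coordSq_midpoint c d
  have h5 : ε * coordSq (c - d) ≤ 0 := by nlinarith
  exact nonpos_of_mul_nonpos_right h5 hε

/-- A jointly continuous objective, convex in the decision variable, has a measurable selection of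
minimizers on a compact convex set: the limit of the minimizers of the regularized objectives. -/
lemma exists_measurable_argmin {Y : Type*} [TopologicalSpace Y] [MeasurableSpace Y]
    [OpensMeasurableSpace Y] {n : ℕ} {K : Set (Fin n → ℂ)} (hK : IsCompact K) (hne : K.Nonempty)
    (hmid : MidpointClosed K) {f : Y → (Fin n → ℂ) → ℝ} (hf : Continuous (Function.uncurry f))
    (hconv : ∀ y, MidpointConvexOn K (f y)) :
    ∃ g : Y → Fin n → ℂ, Measurable g ∧ ∀ y, g y ∈ K ∧ ∀ c ∈ K, f y (g y) ≤ f y c := by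
  have hfy : ∀ y, Continuous (f y) := fun y => hf.comp (Continuous.prodMk_right y)
  set ε : ℕ → ℝ := fun k => 1 / ((k : ℝ) + 1) with hε
  have hεpos : ∀ k, 0 < ε k := fun k => Nat.one_div_pos_of_nat
  choose G hGK hGmin using fun (k : ℕ) (y : Y) => exists_argmin_regularized hK hne (hfy y) (ε k)
  have hGcont : ∀ k, Continuous (G k) := by
    intro k
    rw [continuous_iff_continuousAt]
    intro y
    -- By compactness it is enough that every cluster point minimizes the limiting regularized
    -- objective, whose minimizer is unique.
    refine hK.tendsto_nhds_of_unique_mapClusterPt (Filter.Eventually.of_forall (hGK k)) ?_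
    intro c hc hclus
    obtain ⟨U, hU, hUc⟩ := mapClusterPt_iff_ultrafilter.1 hclus
    refine argmin_regularized_unique hmid (hconv y) (hεpos k) hc (hGK k y) (fun c' hc' => ?_)
      (hGmin k y)
    have hUy : Filter.Tendsto (fun z : Y => z) U (nhds y) := hU
    have h1 : Filter.Tendsto (fun z => f z (G k z) + ε k * coordSq (G k z)) U
        (nhds (f y c + ε k * coordSq c)) :=
      ((hf.tendsto (y, c)).comp (hUy.prodMk_nhds hUc)).add
        (((continuous_coordSq.tendsto c).comp hUc).const_mul _)
    have h2 : Filter.Tendsto (fun z => f z c' + ε k * coordSq c') U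
        (nhds (f y c' + ε k * coordSq c')) :=
      ((hf.tendsto (y, c')).comp (hUy.prodMk_nhds tendsto_const_nhds)).add tendsto_const_nhds
    exact le_of_tendsto_of_tendsto' h1 h2 fun z => hGmin k z c' hc'
  have hsel : ∀ y, ∃ c, (c ∈ K ∧ ∀ c' ∈ K, f y c ≤ f y c') ∧
      Filter.Tendsto (fun k => G k y) Filter.atTop (nhds c) := by
    intro y
    set S : Set (Fin n → ℂ) := {c | c ∈ K ∧ ∀ c' ∈ K, f y c ≤ f y c'} with hS
    have hSclosed : IsClosed {c | ∀ c' ∈ K, f y c ≤ f y c'} := by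
      simp only [Set.ofPred_forall]
      exact isClosed_iInter fun c' => isClosed_iInter fun _ => isClosed_le (hfy y) continuous_const
    have hScomp : IsCompact S := hK.inter_right hSclosed
    have hSne : S.Nonempty := by
      obtain ⟨c, hc, h⟩ := hK.exists_isMinOn hne (hfy y).continuousOn
      exact ⟨c, hc, fun c' hc' => h hc'⟩
    have hSmid : MidpointClosed S := by
      rintro c ⟨hc, hcm⟩ d ⟨hd, hdm⟩
      refine ⟨hmid c hc d hd, fun c' hc' => ?_⟩
      linarith [hconv y c hc d hd, hcm c' hc', hdm c' hc']
    -- The limit is the minimizer of smallest `coordSq`: the zero objective with weight 1 on the set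
    -- `S` of all minimizers.
    obtain ⟨c, hc, hcmin⟩ := exists_argmin_regularized hScomp hSne
      (continuous_const (y := (0 : ℝ))) 1
    refine ⟨c, hc, hK.tendsto_nhds_of_unique_mapClusterPt
      (Filter.Eventually.of_forall fun k => hGK k y) ?_⟩
    intro d hd hclus
    obtain ⟨U, hU, hUd⟩ := mapClusterPt_iff_ultrafilter.1 hclus
    have hε0 : Filter.Tendsto ε U (nhds 0) := tendsto_one_div_add_atTop_nhds_zero_nat.mono_left hU
    have hQ := (continuous_coordSq.tendsto d).comp hUd
    have hdS : d ∈ S := by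
      refine ⟨hd, fun c' hc' => ?_⟩
      have h1 := (((hfy y).tendsto d).comp hUd).add (hε0.mul hQ)
      have h2 : Filter.Tendsto (fun k => f y c' + ε k * coordSq c') U
          (nhds (f y c' + 0 * coordSq c')) := tendsto_const_nhds.add (hε0.mul_const _)
      have h3 := le_of_tendsto_of_tendsto' h1 h2 fun k => hGmin k y c' hc'
      simpa using h3
    refine argmin_regularized_unique hSmid (f := fun _ => 0) (fun _ _ _ _ => by simp) one_pos hdS hc
      (fun c' hc' => ?_) hcmin
    -- A true minimizer `c'` has no larger objective than `G k y`, so optimality of `G k y` forces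
    -- its penalty to be the smaller one.
    have h4 : coordSq d ≤ coordSq c' := by
      refine le_of_tendsto' hQ fun k => ?_
      have h5 := hGmin k y c' hc'.1
      have h6 := hc'.2 _ (hGK k y)
      have h7 : ε k * coordSq (G k y) ≤ ε k * coordSq c' := by linarith
      exact le_of_mul_le_mul_left h7 (hεpos k)
    linarith
  choose g hg hglim using hsel
  exact ⟨g, measurable_of_tendsto_metrizable (fun k => (hGcont k).measurable)
    (tendsto_pi_nhds.2 hglim), hg⟩

lemma dftU_zero {m : ℕ} (l : Fin (m + 1)) : dftU (fun _ => (0 : ℂ)) l = 0 := by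
  simp [dftU]

lemma dftU_midpoint {m : ℕ} (c c' : Fin (m + 1) → ℂ) (l : Fin (m + 1)) :
    dftU (fun i => (c i + c' i) / 2) l = (dftU c l + dftU c' l) / 2 := by
  simp only [dftU]
  rw [← mul_add, ← Finset.sum_add_distrib, mul_div_assoc, Finset.sum_div]
  congr 1
  refine Finset.sum_congr rfl fun t _ => ?_
  ring

lemma filterApply_midpoint {m : ℕ} (k : ℕ) (c c' : Fin (m + 1) → ℂ) (y : Signal) (t : ℤ) :
    filterApply k (fun i => (c i + c' i) / 2) y t =
      (filterApply k c y t + filterApply k c' y t) / 2 := by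
  simp only [filterApply]
  rw [← Finset.sum_add_distrib, Finset.sum_div]
  refine Finset.sum_congr rfl fun t _ => ?_
  ring

lemma continuous_filterApply {m : ℕ} (k : ℕ) (t : ℤ) :
    Continuous fun p : Signal × (Fin (m + 1) → ℂ) => filterApply k p.2 p.1 t := by
  unfold filterApply
  fun_prop

namespace LSProblem

/-- Boundedness comes from duality applied to the coordinate functionals. -/
lemma isCompact_feasible (w : LSProblem) : IsCompact {c | w.Feasible c} := by
  refine Metric.isCompact_of_isClosed_isBounded ?_ ?_
  · refine isClosed_le ?_ continuous_const
    unfold dftU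
    fun_prop
  · rw [isBounded_iff_forall_norm_le]
    refine ⟨|w.rho / (w.m + 1)|, fun c hc => (pi_norm_le_iff_of_nonneg (abs_nonneg _)).2 fun j => ?_⟩
    have h := hc.norm_sum_mul_le (Pi.single j 1) (B := 1) fun l => by
      rw [Finset.sum_eq_single j]
      · rw [Pi.single_eq_same, mul_one, norm_dftRoot_zpow]
      · intro i _ hi
        rw [Pi.single_eq_of_ne hi, mul_zero]
      · simp
    rw [Finset.sum_eq_single j] at h
    · rw [Pi.single_eq_same, mul_one, mul_one] at h
      exact h.trans (le_abs_self _)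
    · intro i _ hi
      rw [Pi.single_eq_of_ne hi, mul_zero]
    · simp

lemma feasible_zero {w : LSProblem} (hw : 0 ≤ w.rho) : w.Feasible fun _ => 0 := by
  simp only [Feasible, dftU_zero, norm_zero, Finset.sum_const_zero]
  positivity

lemma midpointClosed_feasible (w : LSProblem) : MidpointClosed {c | w.Feasible c} := by
  intro c hc c' hc'
  simp only [Set.mem_ofPred_eq, Feasible] at hc hc' ⊢
  have : ∑ l, ‖dftU (fun i => (c i + c' i) / 2) l‖ ≤ ∑ l, (‖dftU c l‖ + ‖dftU c' l‖) / 2 := by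
    refine Finset.sum_le_sum fun l _ => ?_
    rw [dftU_midpoint, norm_div, Complex.norm_ofNat]
    gcongr
    exact norm_add_le _ _
  rw [← Finset.sum_div, Finset.sum_add_distrib] at this
  linarith

lemma midpointConvexOn_residual (w : LSProblem) (y : Signal) (K : Set (Fin (w.m + 1) → ℂ)) :
    MidpointConvexOn K (w.residual y) := by
  intro c _ c' _
  simp only [residual]
  rw [← Finset.sum_add_distrib, Finset.sum_div]
  refine Finset.sum_le_sum fun t _ => ?_
  rw [filterApply_midpoint]
  set p := y t - filterApply w.k c y t with hp
  set q := y t - filterApply w.k c' y t with hq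
  have h1 : y t - (filterApply w.k c y t + filterApply w.k c' y t) / 2 = (p + q) / 2 := by
    rw [hp, hq]; ring
  rw [h1, norm_div, Complex.norm_ofNat]
  have h2 := norm_add_le p q
  have h3 : ‖p + q‖ ^ 2 ≤ (‖p‖ + ‖q‖) ^ 2 := by gcongr
  nlinarith [sq_nonneg (‖p‖ - ‖q‖)]

lemma continuous_residual (w : LSProblem) : Continuous (Function.uncurry w.residual) := by
  unfold residual Function.uncurry
  have := fun t => continuous_filterApply (m := w.m) w.k t
  fun_prop

/-- The restriction of the observations to `[-N, N]`. -/
noncomputable def truncate (N : ℕ) (y : Signal) : Signal :=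
  fun t => if t ∈ Set.Icc (-(N : ℤ)) N then y t else 0

lemma measurable_truncate (N : ℕ) : Measurable (truncate N) := by
  refine measurable_pi_lambda _ fun t => ?_
  unfold truncate
  split_ifs <;> fun_prop

lemma Admissible.filterApply_truncate {w : LSProblem} {N : ℕ} (hw : w.Admissible N) (y : Signal)
    (c : Fin (w.m + 1) → ℂ) {t : ℤ} (ht : t ∈ Set.Icc w.left w.right) :
    filterApply w.k c (truncate N y) t = filterApply w.k c y t := by
  obtain ⟨-, h1, -, h2, h3⟩ := hw
  refine Finset.sum_congr rfl fun j _ => ?_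
  rw [truncate, if_pos]
  have := j.2
  rw [Set.mem_Icc] at ht ⊢
  omega

lemma Admissible.residual_truncate {w : LSProblem} {N : ℕ} (hw : w.Admissible N) (y : Signal)
    (c : Fin (w.m + 1) → ℂ) : w.residual (truncate N y) c = w.residual y c := by
  refine Finset.sum_congr rfl fun t ht => ?_
  rw [Finset.mem_Icc] at ht
  rw [hw.filterApply_truncate y c ht, truncate, if_pos]
  obtain ⟨-, h1, -, h2, h3⟩ := hw
  rw [Set.mem_Icc]
  omega

/-- Optimal solutions can be chosen as a measurable function of the observations on `[-N, N]`. -/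
lemma Admissible.exists_measurable_solution {w : LSProblem} {N : ℕ} (hw : w.Admissible N) :
    ∃ φ : Signal → Fin (w.m + 1) → ℂ, Measurable φ ∧ (∀ y, w.IsSolution y (φ y)) ∧
      ∀ y, φ (truncate N y) = φ y := by
  obtain ⟨g, hg, hmin⟩ := exists_measurable_argmin w.isCompact_feasible
    ⟨_, feasible_zero (zero_le_one.trans hw.2.2.1)⟩ w.midpointClosed_feasible w.continuous_residual
    fun y => w.midpointConvexOn_residual y _
  -- Truncating the data does not change the residual of an admissible problem, and it makes the
  -- solution depend on `[-N, N]` only.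
  refine ⟨fun y => g (truncate N y), hg.comp (measurable_truncate N), fun y => ⟨(hmin _).1, ?_⟩, ?_⟩
  · intro c' hc'
    have h := (hmin (truncate N y)).2 c' hc'
    rwa [hw.residual_truncate, hw.residual_truncate] at h
  · intro y
    have : truncate N (truncate N y) = truncate N y := by
      ext t
      simp only [truncate]
      split_ifs <;> rfl
    simp only [this]

end LSProblem

/-! ### Risk on one window and combination of windows. -/

/-- The squared error of a symmetric constrained least-squares filter on its window. -/
lemma IsStdComplexNoise.exists_window_bound {Ω : Type*} [MeasurableSpace Ω] {P : Measure Ω}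
    [IsProbabilityMeasure P] {ζ : ℤ → Ω → ℂ} (hζ : IsStdComplexNoise P ζ)
    {V : Submodule ℂ Signal} [FiniteDimensional ℂ V] (hV : ShiftInvariant V) {s : ℕ}
    (hs : Module.finrank ℂ V ≤ s) (hs1 : 1 ≤ s) {a b : ℤ} {h : ℕ} (hab : b - a ≤ h)
    {w : LSProblem} (hw : w = symProblem a b h s) :
    ∃ Ψ : Ω → ℝ, MeanLE P Ψ (1024 * s ^ 2 * (Real.log (2 * h + 1 : ℕ) + 2)) ∧
      ∀ (ω : Ω) (σ : ℝ), 0 ≤ σ → ∀ x ∈ V, ∀ c,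
        w.IsSolution (observe x σ fun r => ζ r ω) c →
        ∑ t ∈ Finset.Icc w.left w.right,
          ‖x t - filterApply w.k c (observe x σ fun r => ζ r ω) t‖ ^ 2 ≤ σ ^ 2 * Ψ ω := by
  subst hw
  obtain ⟨A, hA, hAle⟩ := hζ.exists_energy_bound a b h s hab
  obtain ⟨G, hG, hGle⟩ := hζ.exists_correlation_bound a b h s hab
  obtain ⟨B, hB, hBle⟩ := hζ.exists_projection_bound V hs (Finset.Icc a b)
  obtain ⟨c₀, hc₀, hrep⟩ := hV.exists_feasible hs a b h
  have hL : 0 ≤ Real.log (2 * h + 1 : ℕ) := Real.log_natCast_nonneg _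
  have hs' : (1 : ℝ) ≤ s := by exact_mod_cast hs1
  refine ⟨fun ω => 3 * A ω + 8 * G ω + 8 * B ω, ?_, fun ω σ hσ x hx c hc => ?_⟩
  · refine (((hA.const_mul (a := 3) (by norm_num)).add (hG.const_mul (a := 8) (by norm_num))
      (by positivity) (by positivity)).add (hB.const_mul (a := 8) (by norm_num))
      (by positivity) (by positivity)).mono ?_
    -- The total is `3·128 + 8·64 + 64 = 960`, the last term being `8·16 s = 64·(2 s)`.
    have h1 : (s : ℝ) ≤ s ^ 2 := by nlinarith
    have h2 : (s : ℝ) * (Real.log (2 * h + 1 : ℕ) + 2) ≤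
        s ^ 2 * (Real.log (2 * h + 1 : ℕ) + 2) := by gcongr
    have h3 : (s : ℝ) * 2 ≤ s * (Real.log (2 * h + 1 : ℕ) + 2) := by gcongr; linarith
    linarith
  · exact LSProblem.IsSolution.oracle hV hσ hx hc hc₀ (fun t => hrep x hx t)
      (hAle ω) (hGle ω) (hBle ω).2 (hBle ω).1

/-- Admissible problems, assigned to the points of `[-N, N]`, can be combined into an estimator. -/
lemma exists_combined_estimator {N J : ℕ} (w : Fin J → LSProblem) (hw : ∀ i, (w i).Admissible N)
    (piece : Set.Icc (-(N : ℤ)) (N : ℤ) → Fin J)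
    (hpiece : ∀ t : Set.Icc (-(N : ℤ)) (N : ℤ),
      (t : ℤ) ∈ Set.Icc (w (piece t)).left (w (piece t)).right) :
    ∃ (xhat : Signal → Signal) (φ : (i : Fin J) → Signal → (Fin ((w i).m + 1) → ℂ)),
      CombinesLSFilters N J xhat ∧ IsEstimator N xhat ∧ (∀ i y, (w i).IsSolution y (φ i y)) ∧
      ∀ (x y : Signal), ∑ t ∈ Finset.Icc (-(N : ℤ)) N, ‖x t - xhat y t‖ ^ 2 ≤
        ∑ i, ∑ t ∈ Finset.Icc (w i).left (w i).right,
          ‖x t - filterApply (w i).k (φ i y) y t‖ ^ 2 := by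
  classical
  choose φ hφm hφs hφt using fun i => (hw i).exists_measurable_solution
  let xhat : Signal → Signal := fun y t => if ht : t ∈ Set.Icc (-(N : ℤ)) (N : ℤ) then
    filterApply (w (piece ⟨t, ht⟩)).k (φ (piece ⟨t, ht⟩) y) y t else 0
  have hx : ∀ (y : Signal) (t : Set.Icc (-(N : ℤ)) (N : ℤ)),
      xhat y (t : ℤ) = filterApply (w (piece t)).k (φ (piece t) y) y (t : ℤ) := fun y t => by
    simp only [xhat, dif_pos t.2]
  refine ⟨xhat, φ, ⟨w, piece, φ, hw, hφs, hpiece, hx⟩, ⟨?_, ?_⟩, hφs, ?_⟩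
  · refine measurable_pi_lambda _ fun t => ?_
    by_cases ht : t ∈ Set.Icc (-(N : ℤ)) (N : ℤ)
    · simp only [xhat, dif_pos ht]
      exact (continuous_filterApply _ t).measurable.comp (measurable_id.prodMk (hφm _))
    · simp only [xhat, dif_neg ht]
      fun_prop
  · intro y y' hyy
    have htr : LSProblem.truncate N y = LSProblem.truncate N y' := by
      ext t
      simp only [LSProblem.truncate]
      split_ifs with ht
      · exact hyy t ht
      · rfl
    ext t
    by_cases ht : t ∈ Set.Icc (-(N : ℤ)) (N : ℤ)
    · rw [hx y ⟨t, ht⟩, hx y' ⟨t, ht⟩, ← hφt _ y, ← hφt _ y', htr,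
        ← (hw _).filterApply_truncate y _ (hpiece ⟨t, ht⟩),
        ← (hw _).filterApply_truncate y' _ (hpiece ⟨t, ht⟩), htr]
    · simp only [xhat, dif_neg ht]
  · intro x y
    set g : Fin J → ℤ → ℝ := fun i t => ‖x t - filterApply (w i).k (φ i y) y t‖ ^ 2 with hg
    have hg0 : ∀ i t, 0 ≤ g i t := fun i t => sq_nonneg _
    calc ∑ t ∈ Finset.Icc (-(N : ℤ)) N, ‖x t - xhat y t‖ ^ 2
        ≤ ∑ t ∈ Finset.Icc (-(N : ℤ)) N,
            ∑ i, if t ∈ Finset.Icc (w i).left (w i).right then g i t else 0 := by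
          refine Finset.sum_le_sum fun t ht => ?_
          have ht' : t ∈ Set.Icc (-(N : ℤ)) (N : ℤ) := by simpa using ht
          have hp : t ∈ Finset.Icc (w (piece ⟨t, ht'⟩)).left (w (piece ⟨t, ht'⟩)).right := by
            simpa using hpiece ⟨t, ht'⟩
          rw [hx y ⟨t, ht'⟩]
          refine le_trans (le_of_eq ?_) (Finset.single_le_sum
            (f := fun i => if t ∈ Finset.Icc (w i).left (w i).right then g i t else 0)
            (fun i _ => ?_) (Finset.mem_univ (piece ⟨t, ht'⟩)))
          · simp only [if_pos hp, hg]
          · split_ifs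
            · exact hg0 i t
            · exact le_rfl
      _ = ∑ i, ∑ t ∈ Finset.Icc (-(N : ℤ)) N,
            if t ∈ Finset.Icc (w i).left (w i).right then g i t else 0 := Finset.sum_comm
      _ ≤ ∑ i, ∑ t ∈ Finset.Icc (w i).left (w i).right, g i t := by
          refine Finset.sum_le_sum fun i _ => ?_
          rw [← Finset.sum_filter]
          refine Finset.sum_le_sum_of_subset_of_nonneg (fun t ht => (Finset.mem_filter.1 ht).2)
            fun t _ _ => hg0 i t

/-! ### The dyadic cover of `[-N, N]`. -/

/-- The window of the points of `[-N, 0]` at distance between `q` and `2 * q - 1` from `-N - 1`,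
fitted by filters on `[-(q - 1), q - 1]`. -/
def leftWindow (N s q : ℕ) : LSProblem :=
  symProblem ((q : ℤ) - N - 1) (min (2 * (q : ℤ) - N - 2) 0) (q - 1) s

/-- The mirror image of `leftWindow`. -/
def rightWindow (N s q : ℕ) : LSProblem :=
  symProblem (max ((N : ℤ) + 2 - 2 * q) 0) ((N : ℤ) + 1 - q) (q - 1) s

/-- The dyadic windows: the even ones are on the left, the odd ones on the right. -/
def dyadicWindow (N s i : ℕ) : LSProblem :=
  if i % 2 = 0 then leftWindow N s (2 ^ (i / 2)) else rightWindow N s (2 ^ (i / 2))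

/-- A window has at most `q = 2 ^ (i / 2)` points and the filter half-width is `q - 1`: this is the
condition `b - a ≤ h` behind the noise bounds. -/
lemma dyadicWindow_eq_symProblem (N s i : ℕ) :
    ∃ (a b : ℤ), b - a ≤ ((2 ^ (i / 2) - 1 : ℕ) : ℤ) ∧
      dyadicWindow N s i = symProblem a b (2 ^ (i / 2) - 1) s := by
  have hq : 1 ≤ 2 ^ (i / 2) := Nat.one_le_two_pow
  unfold dyadicWindow
  generalize 2 ^ (i / 2) = q at *
  split_ifs
  · exact ⟨_, _, by omega, rfl⟩
  · exact ⟨_, _, by omega, rfl⟩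

/-- The outer end of a window is `q - 1` steps inside `[-N, N]`, exactly the half-width; cutting at
0 and `q ≤ N + 1` take care of the other end. -/
lemma dyadicWindow_admissible {N s i : ℕ} (hs : 1 ≤ s) (hi : i < 2 * (Nat.log 2 (N + 1) + 1)) :
    (dyadicWindow N s i).Admissible N := by
  have hq : 1 ≤ 2 ^ (i / 2) := Nat.one_le_two_pow
  have hqN : 2 ^ (i / 2) ≤ N + 1 :=
    (Nat.pow_le_pow_right two_pos (by omega)).trans (Nat.pow_log_le_self 2 (by omega))
  have hrho : (1 : ℝ) ≤ 4 * s := by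
    have : (1 : ℝ) ≤ s := by exact_mod_cast hs
    linarith
  unfold dyadicWindow
  generalize 2 ^ (i / 2) = q at *
  split_ifs
  · simp only [leftWindow, symProblem, LSProblem.Admissible]
    refine ⟨?_, ?_, hrho, ?_, ?_⟩ <;> omega
  · simp only [rightWindow, symProblem, LSProblem.Admissible]
    refine ⟨?_, ?_, hrho, ?_, ?_⟩ <;> omega

/-- The index of the dyadic window that contains `t`. -/
def dyadicIndex (N : ℕ) (t : ℤ) : ℕ :=
  2 * Nat.log 2 (N + 1 - t.natAbs) + if t ≤ 0 then 0 else 1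

lemma dyadicIndex_lt (N : ℕ) (t : ℤ) : dyadicIndex N t < 2 * (Nat.log 2 (N + 1) + 1) := by
  have : Nat.log 2 (N + 1 - t.natAbs) ≤ Nat.log 2 (N + 1) := Nat.log_mono_right (by omega)
  unfold dyadicIndex
  split_ifs <;> omega

/-- With `q` the largest power of two not exceeding `N + 1 - |t|`, this distance to the outside lies
in `[q, 2q)`. -/
lemma mem_dyadicWindow {N s : ℕ} {t : ℤ} (ht : t ∈ Set.Icc (-(N : ℤ)) N) :
    t ∈ Set.Icc (dyadicWindow N s (dyadicIndex N t)).left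
      (dyadicWindow N s (dyadicIndex N t)).right := by
  rw [Set.mem_Icc] at ht
  have h1 : 2 ^ Nat.log 2 (N + 1 - t.natAbs) ≤ N + 1 - t.natAbs :=
    Nat.pow_log_le_self 2 (by omega)
  have h2 : N + 1 - t.natAbs < 2 ^ Nat.log 2 (N + 1 - t.natAbs) * 2 := by
    rw [← pow_succ]
    exact Nat.lt_pow_succ_log_self one_lt_two _
  unfold dyadicWindow dyadicIndex
  split_ifs with h3 h4 h4
  · rw [show (2 * Nat.log 2 (N + 1 - t.natAbs) + 0) / 2 = Nat.log 2 (N + 1 - t.natAbs) by omega]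
    generalize 2 ^ Nat.log 2 (N + 1 - t.natAbs) = q at *
    simp only [leftWindow, symProblem, Set.mem_Icc]
    omega
  · omega
  · omega
  · rw [show (2 * Nat.log 2 (N + 1 - t.natAbs) + 1) / 2 = Nat.log 2 (N + 1 - t.natAbs) by omega]
    generalize 2 ^ Nat.log 2 (N + 1 - t.natAbs) = q at *
    simp only [rightWindow, symProblem, Set.mem_Icc]
    omega

lemma one_le_two_mul_log (N : ℕ) : (1 : ℝ) ≤ 2 * Real.log (N + 2) := by
  have h1 := Real.log_two_gt_d9
  have h2 : Real.log 2 ≤ Real.log (N + 2) := Real.log_le_log two_pos (by linarith [N.cast_nonneg (α := ℝ)])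
  linarith

lemma card_dyadicWindow_le (N : ℕ) :
    ((2 * (Nat.log 2 (N + 1) + 1) : ℕ) : ℝ) ≤ 8 * Real.log (N + 2) := by
  have h0 := Real.log_two_gt_d9
  have h1 : (Nat.log 2 (N + 1) : ℝ) * Real.log 2 ≤ Real.log (N + 2) := by
    rw [← Real.log_pow]
    refine Real.log_le_log (by positivity) ?_
    have : 2 ^ Nat.log 2 (N + 1) ≤ N + 2 := (Nat.pow_log_le_self 2 (by omega)).trans (by omega)
    exact_mod_cast this
  have h2 := one_le_two_mul_log N
  have h3 : (0 : ℝ) ≤ Nat.log 2 (N + 1) := Nat.cast_nonneg _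
  push_cast
  nlinarith

/-! ### Summation over the windows. -/

/-- The mean squared error of the combined estimator is of order `σ² s² ln² N` for all the signals
of a shift-invariant space of dimension at most `s`. -/
lemma exists_estimator (N s : ℕ) (hs1 : 1 ≤ s) :
    ∃ (J : ℕ) (xhat : Signal → Signal),
      (J : ℝ) ≤ 8 * Real.log (N + 2) ∧ CombinesLSFilters N J xhat ∧ IsEstimator N xhat ∧
      ∀ (Ω : Type*) [MeasurableSpace Ω] (P : Measure Ω) [IsProbabilityMeasure P]
        (ζ : ℤ → Ω → ℂ), IsStdComplexNoise P ζ → ∀ (σ : ℝ), 0 ≤ σ → ∀ x : Signal,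
          IsGenHarmonicOscillation s x →
            totalMSE P N xhat x σ ζ ≤
              ENNReal.ofReal (49152 * σ ^ 2 * (s : ℝ) ^ 2 * Real.log (N + 2) ^ 2) := by
  set J := 2 * (Nat.log 2 (N + 1) + 1) with hJ
  obtain ⟨xhat, φ, hcomb, hest, hsol, hle⟩ := exists_combined_estimator (N := N) (J := J)
    (fun i => dyadicWindow N s i) (fun i => dyadicWindow_admissible hs1 i.2)
    (fun t => ⟨dyadicIndex N t, dyadicIndex_lt N t⟩) fun t => mem_dyadicWindow t.2
  refine ⟨J, xhat, card_dyadicWindow_le N, hcomb, hest, ?_⟩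
  intro Ω _ P _ ζ hζ σ hσ x hx
  obtain ⟨V, hVfin, hVs, hV, hxV⟩ := hx.exists_shiftInvariant
  have hΛ := one_le_two_mul_log N
  have hΛ0 : 0 ≤ Real.log (N + 2) := by linarith
  have hΨ : ∀ i : Fin J, ∃ Ψ : Ω → ℝ, MeanLE P Ψ (1024 * s ^ 2 * (6 * Real.log (N + 2))) ∧
      ∀ ω, ∑ t ∈ Finset.Icc (dyadicWindow N s i).left (dyadicWindow N s i).right,
        ‖x t - filterApply (dyadicWindow N s i).k (φ i (observe x σ fun r => ζ r ω))
          (observe x σ fun r => ζ r ω) t‖ ^ 2 ≤ σ ^ 2 * Ψ ω := by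
    intro i
    obtain ⟨a, b, hab, hw⟩ := dyadicWindow_eq_symProblem N s i
    have hq : 2 ^ ((i : ℕ) / 2) ≤ N + 1 :=
      (Nat.pow_le_pow_right two_pos (by omega)).trans (Nat.pow_log_le_self 2 (by omega))
    obtain ⟨Ψ, hm, hb⟩ := hζ.exists_window_bound hV hVs hs1 hab hw
    refine ⟨Ψ, hm.mono ?_, fun ω => hb ω σ hσ x hxV _ (hsol i _)⟩
    -- The logarithm costs `2 ln (N + 2)` and the additive 2 costs `4 ln (N + 2)`, hence the factor
    -- 6.
    have h1 : Real.log (2 * (2 ^ ((i : ℕ) / 2) - 1) + 1 : ℕ) ≤ 2 * Real.log (N + 2) := by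
      rw [← Nat.cast_ofNat (R := ℝ) (n := 2), ← Real.log_pow]
      refine Real.log_le_log (by positivity) ?_
      have : 2 * (2 ^ ((i : ℕ) / 2) - 1) + 1 ≤ (N + 2) ^ 2 := by
        have : 2 * (2 ^ ((i : ℕ) / 2) - 1) + 1 ≤ 2 * (N + 2) := by omega
        nlinarith
      exact_mod_cast this
    gcongr
    linarith
  choose Ψ hΨm hΨle using hΨ
  have hΨb : MeanLE P (fun ω => σ ^ 2 * ∑ i, Ψ i ω)
      (σ ^ 2 * (J * (1024 * s ^ 2 * (6 * Real.log (N + 2))))) := by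
    have := (MeanLE.sum Finset.univ (fun i _ => hΨm i) (by positivity)).const_mul (sq_nonneg σ)
    simpa using this
  have hpt : ∀ ω, ∑ t ∈ Finset.Icc (-(N : ℤ)) (N : ℤ),
      ‖x t - xhat (observe x σ (fun r => ζ r ω)) t‖ₑ ^ 2 ≤
      ENNReal.ofReal (σ ^ 2 * ∑ i, Ψ i ω) := by
    intro ω
    have h1 : ∑ t ∈ Finset.Icc (-(N : ℤ)) (N : ℤ),
        ‖x t - xhat (observe x σ (fun r => ζ r ω)) t‖ₑ ^ 2 =
        ENNReal.ofReal (∑ t ∈ Finset.Icc (-(N : ℤ)) (N : ℤ),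
          ‖x t - xhat (observe x σ (fun r => ζ r ω)) t‖ ^ 2) := by
      rw [ENNReal.ofReal_sum_of_nonneg fun _ _ => sq_nonneg _]
      refine Finset.sum_congr rfl fun t _ => ?_
      rw [ENNReal.ofReal_pow (norm_nonneg _), ofReal_norm]
    rw [h1]
    refine ENNReal.ofReal_le_ofReal ((hle _ _).trans ?_)
    rw [Finset.mul_sum]
    exact Finset.sum_le_sum fun i _ => hΨle i ω
  refine (lintegral_mono hpt).trans (hΨb.2.trans (ENNReal.ofReal_le_ofReal ?_))
  have h1 : (J : ℝ) ≤ 8 * Real.log (N + 2) := card_dyadicWindow_le N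
  -- The constant is `8 · 1024 · 6 = 49152`.
  calc σ ^ 2 * (J * (1024 * (s : ℝ) ^ 2 * (6 * Real.log (N + 2))))
      ≤ σ ^ 2 * (8 * Real.log (N + 2) * (1024 * (s : ℝ) ^ 2 * (6 * Real.log (N + 2)))) := by gcongr
    _ = _ := by ring

theorem mainTheorem6 :
    ∃ C : ℝ, 0 < C ∧ ∀ u : ℝ, 1 < u → ∃ Cu : ℝ, 0 < Cu ∧
      ∀ N s : ℕ, 1 ≤ s →
        ∃ (J : ℕ) (xhat : Signal → Signal),
          (J : ℝ) ≤ C * Real.log (N + 2) ∧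
          CombinesLSFilters N J xhat ∧
          IsEstimator N xhat ∧
          ∀ (Ω : Type*) [MeasurableSpace Ω] (P : Measure Ω) [IsProbabilityMeasure P]
            (ζ : ℤ → Ω → ℂ), IsStdComplexNoise P ζ →
            ∀ (σ : ℝ), 0 ≤ σ → ∀ x : Signal,
              (IsGenHarmonicOscillation s x →
                totalMSE P N xhat x σ ζ ≤
                  ENNReal.ofReal (C * σ ^ 2 * (s : ℝ) ^ 3 * Real.log (N + 2) ^ 2)) ∧
              (IsSeparatedHarmonicOscillation u N s x →
                totalMSE P N xhat x σ ζ ≤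
                  ENNReal.ofReal (Cu * σ ^ 2 * (s : ℝ) ^ 2 * Real.log (N + 2) ^ 2)) := by
  -- One constant serves as `C` and as every `C_u`, since the `s²` bound already holds for all
  -- generalized oscillations.
  refine ⟨49152, by norm_num, fun u _ => ⟨49152, by norm_num, fun N s hs => ?_⟩⟩
  obtain ⟨J, xhat, hJ, hcomb, hest, hmse⟩ := exists_estimator N s hs
  have hs' : (1 : ℝ) ≤ s := by exact_mod_cast hs
  refine ⟨J, xhat, hJ.trans ?_, hcomb, hest, fun Ω _ P _ ζ hζ σ hσ x => ⟨fun hx => ?_, fun hx =>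
    hmse Ω P ζ hζ σ hσ x hx.isGen⟩⟩
  · have := one_le_two_mul_log N
    linarith
  · refine (hmse Ω P ζ hζ σ hσ x hx).trans (ENNReal.ofReal_le_ofReal ?_)
    gcongr
    · norm_num
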